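/- **Setting.** Let $\mathcal H=(H_1,\dots,H_n)$, $n\ge 1$, be known probability distributions on a measurable space $\mathcal X$ with densities $H_i(x)$ with respect to a common reference measure, and let $P$ be an unknown probability distribution on $\mathcal X$. Write $\|P_1-P_2\|_{TV}=\sup_S|P_1(S)-P_2(S)|$ (over measurable $S$) and $\mathrm{OPT}=\min_i\|H_i-P\|_{TV}$. The Scheffé sets are $S_{i,j}=\{x: H_i(x)<H_j(x)\}$ for $i\le j$ and $S_{i,j}=S_{j,i}$ for $i>j$. An algorithm may access the hypotheses only through the queries "is $H_i(x)<H_j(x)$?" and "what is $H_i(S_{i,j})$?", and accesses $P$ only through an i.i.d. data set $D=(x_1,\dots,x_s)$ from $P$. For a data set $D$ put $\hat w_i(H_j)=\bigl|H_j(S_{i,j})-\tfrac1s\#\{l: x_l\in S_{i,j}\}\bigr|$. **Algorithm 1.** Input: $\varepsilon,\beta,\sigma\in(0,1)$. With absolute constants $c_s,c_T,c_k>0$ set $$s=\Bigl\lceil c_s\tfrac{\log^3(n/\beta)}{\beta^2\sigma^2\varepsilon}\Bigr\rceil,\quad T=\min\Bigl(\Bigl\lceil c_T\tfrac{\log(n/\beta)}{\beta\sigma}\Bigr\rceil,n\Bigr),\quad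 k=\Bigl\lceil c_k\tfrac{\log(n/\beta)}{\beta}\Bigr\rceil,\quad \varepsilon_E=\tfrac{\varepsilon}{2(kT+1)},\quad \varepsilon_S=\tfrac{\varepsilon}{2T}.$$ Draw $D$ ($s$ samples from $P$); let $A=\emptyset$ and $\tilde W(H_j)=0$ for all $j$. Throughout, $Q$ denotes the distribution on $\mathcal H$ with $Q(H_j)\propto\exp(-\varepsilon_E s\tilde W(H_j)/2)$ for the current values of $\tilde W$. Repeat at most $T$ times: draw a list $K$ of $k$ independent hypotheses from $Q$; draw $\rho\sim\mathrm{Lap}\bigl(\tfrac{2/s}{\varepsilon_S/2}\bigr)$; go through $H_i\in\mathcal H\setminus A$ in order, draw $\nu_i\sim\mathrm{Lap}\bigl(\tfrac{4/s}{\varepsilon_S/2}\bigr)$, let $\mathrm{score}(H_i)$ be the $\lceil\tfrac{\beta}{8}k\rceil$-th largest of the values $\hat w_i(H_j)-\tilde W(H_j)$, $H_j\in K$ (with multiplicity), and stop at the first $H_i$ with $\mathrm{score}(H_i)+\nu_i\ge\tfrac34\cdot\tfrac\sigma4+\rho$. If such an $H_i$ is found, add it to $A$ and replace each $\tilde W(H_j)$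 by $\max(\tilde W(H_j),\hat w_i(H_j))$; otherwise leave the loop. Finally output $\hat H\sim Q$. **Theorem 4.1.** The constants $c_s,c_T,c_k>0$ can be chosen so that for all $n\ge1$ and all $\varepsilon,\beta,\sigma\in(0,1)$ Algorithm 1 is a $(3,\varepsilon,\beta,\sigma)$-proper learner for private hypothesis selection, that is, for every $\mathcal X$ and $\mathcal H$: 1. (pure differential privacy in the central model) for all data sets $D,D'\in\mathcal X^s$ that differ in exactly one entry and every set $S$ of outputs, $\Pr[\text{output on }D\in S]\le e^{\varepsilon}\Pr[\text{output on }D'\in S]$; 2. for every $P$, with probability at least $1-\beta$ over the samples and the internal randomness, the output $\hat H\in\mathcal H$ satisfies $\|\hat H-P\|_{TV}\le 3\cdot\mathrm{OPT}+\sigma$. Moreover, uniformly over $n\ge2$ and $\varepsilon,\beta,\sigma\in(0,1)$ (with absolute implied constants), it uses $$s=\Theta\Bigl(\frac{\log^3(n/\beta)}{\beta^2\sigma^2\varepsilon}\Bigr)$$ samples, and its worst-case running time is $$\Theta(F),\qquad F=\min\Bigl(\frac{n\log^5(n/\beta)}{\beta^4\sigma^3\varepsilon},\ \frac{n^2\log^4(n/\beta)}{\beta^3\sigma^2\varepsilon}\Bigr):$$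 there are absolute constants $a,b>0$ such that on every $\mathcal X$, $\mathcal H$ and data set the number of steps exceeds $bF$ with probability $0$ and is at least $aF$ with positive probability (over the internal randomness). Here a sample, a query, an elementary operation on real numbers or stored data, and a Laplace draw cost one step each, and drawing an index from a list of $n$ weights costs $n$ steps. -/

import Mathlib

open MeasureTheory
open scoped ENNReal

universe u

noncomputable section

namespace HypSel

/-! ### Hypotheses, total variation distance, Scheffé sets -/

/-- A list of `n` known distributions over `X`, given by probability density functions with
respect to a common reference measure. -/
structure HypothesisClass (X : Type u) [MeasurableSpace X] (n : ℕ) where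
  ref : Measure X
  pdf : Fin n → X → ℝ≥0∞
  measurable_pdf : ∀ i, Measurable (pdf i)
  lintegral_pdf : ∀ i, ∫⁻ x, pdf i x ∂ref = 1

/-- The distribution `H_i`. -/
def HypothesisClass.law {X : Type u} [MeasurableSpace X] {n : ℕ} (H : HypothesisClass X n)
    (i : Fin n) : Measure X :=
  H.ref.withDensity (H.pdf i)

/-- The Scheffé set `S_{i,j}`: it is `{x | H_i(x) < H_j(x)}` if `i ≤ j`, and `S_{j,i}` if `i > j`. -/
def HypothesisClass.scheffe {X : Type u} [MeasurableSpace X] {n : ℕ} (H : HypothesisClass X n)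
    (i j : Fin n) : Set X :=
  {x | H.pdf (min i j) x < H.pdf (max i j) x}

/-- Total variation distance: the supremum of `|P(S) - Q(S)|` over measurable sets `S`. -/
def tvDist {X : Type u} [MeasurableSpace X] (P Q : Measure X) : ℝ :=
  ⨆ S : {S : Set X // MeasurableSet S}, |P.real S - Q.real S|

/-- `OPT`, the smallest total variation distance between `P` and a hypothesis. -/
def HypothesisClass.opt {X : Type u} [MeasurableSpace X] {n : ℕ} (H : HypothesisClass X n)
    (P : Measure X) : ℝ :=
  ⨅ i : Fin n, tvDist (H.law i) P

/-- The Laplace distribution with mean `0` and scale `b > 0`. -/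
def laplace (b : ℝ) : Measure ℝ :=
  volume.withDensity fun x => ENNReal.ofReal (Real.exp (-|x| / b) / (2 * b))

/-! ### Randomized programs with query access to the hypotheses and a step count -/

/-- Randomized real-RAM programs over data points of type `X` that know the `n` hypotheses only
through queries. A program is a tree of instructions:
* `ret a`: halt with result `a`;
* `step p`: one elementary operation, then `p`;
* `less i j x k`: ask whether `H_i(x) < H_j(x)`;
* `mass i j k`: ask for the probability mass `H_i(S_{i,j})`;
* `laplace b k`: draw from the Laplace distribution of scale `b`;
* `draw w k`: draw an index with probability proportional to the stored weights `w`. -/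
inductive Prog (X : Type u) (n : ℕ) (α : Type) : Type u
  | ret (a : α) : Prog X n α
  | step (p : Prog X n α) : Prog X n α
  | less (i j : Fin n) (x : X) (k : Bool → Prog X n α) : Prog X n α
  | mass (i j : Fin n) (k : ℝ → Prog X n α) : Prog X n α
  | laplace (b : ℝ) (k : ℝ → Prog X n α) : Prog X n α
  | draw (w : Fin n → ℝ) (k : Fin n → Prog X n α) : Prog X n α

namespace Prog

/-- Sequential composition. -/
def bind {X : Type u} {n : ℕ} {α β : Type} : Prog X n α → (α → Prog X n β) → Prog X n β
  | ret a, g => g a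
  | step p, g => step (p.bind g)
  | less i j x k, g => less i j x fun b => (k b).bind g
  | mass i j k, g => mass i j fun r => (k r).bind g
  | laplace b k, g => laplace b fun r => (k r).bind g
  | draw w k, g => draw w fun j => (k j).bind g

instance instMonad (X : Type u) (n : ℕ) : Monad (Prog X n) where
  pure := ret
  bind := bind

/-- Semantics: the expectation of `f (result) (number of steps)` over the internal randomness of a
program, when the queries are answered according to `H`. Every instruction costs one step, except
that drawing an index from a list of `n` weights costs `n` steps (a linear scan), and halting is
free. -/
def expect {X : Type u} [MeasurableSpace X] {n : ℕ} (H : HypothesisClass X n) {α : Type} :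
    Prog X n α → (α → ℕ → ℝ≥0∞) → ℝ≥0∞
  | ret a, f => f a 0
  | step p, f => p.expect H fun a t => f a (t + 1)
  | less i j x k, f => (k (decide (H.pdf i x < H.pdf j x))).expect H fun a t => f a (t + 1)
  | mass i j k, f => (k ((H.law i).real (H.scheffe i j))).expect H fun a t => f a (t + 1)
  | laplace b k, f => ∫⁻ r, (k r).expect H (fun a t => f a (t + 1)) ∂(HypSel.laplace b)
  | draw w k, f =>
      ∑ j, ENNReal.ofReal (w j / ∑ i, w i) * (k j).expect H fun a t => f a (t + n)

open Classical in
/-- The probability, over the internal randomness of the program, that its result `a` and its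
number of steps `t` satisfy `E a t`. -/
def prob {X : Type u} [MeasurableSpace X] {n : ℕ} (H : HypothesisClass X n) {α : Type}
    (p : Prog X n α) (E : α → ℕ → Prop) : ℝ≥0∞ :=
  p.expect H fun a t => if E a t then 1 else 0

/-- One elementary operation with result `a`: an arithmetic expression of bounded size
(`+`, `-`, `*`, `/`, `exp`, `max`, `|·|`) in stored values, a comparison, or a list or memory
access. -/
def op {X : Type u} {n : ℕ} {α : Type} (a : α) : Prog X n α :=
  step (ret a)

/-- `m` elementary operations without result. -/
def steps {X : Type u} {n : ℕ} : ℕ → Prog X n Unit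
  | 0 => ret ()
  | m + 1 => step (steps m)

/-- Query an ordered pair of hypotheses at a point. -/
def askLess {X : Type u} {n : ℕ} (i j : Fin n) (x : X) : Prog X n Bool :=
  less i j x ret

/-- Query the mass `H_i(S_{i,j})`. -/
def askMass {X : Type u} {n : ℕ} (i j : Fin n) : Prog X n ℝ :=
  mass i j ret

/-- Draw Laplace noise of scale `b`. -/
def drawLaplace {X : Type u} {n : ℕ} (b : ℝ) : Prog X n ℝ :=
  laplace b ret

/-- Draw an index with probability proportional to `w`. -/
def drawIndex {X : Type u} {n : ℕ} (w : Fin n → ℝ) : Prog X n (Fin n) :=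
  draw w ret

end Prog

open Prog

/-! ### The algorithm -/

/-- Fill the entries of an array that are listed in the last argument. -/
def fill {X : Type u} {n : ℕ} (g : Fin n → Prog X n ℝ) (a : Fin n → ℝ) :
    List (Fin n) → Prog X n (Fin n → ℝ)
  | [] => pure a
  | j :: js => do
      let v ← g j
      fill g (Function.update a j v) js

/-- Compute the array with entries `g 0, …, g (n-1)`. -/
def tabulate {X : Type u} {n : ℕ} (g : Fin n → Prog X n ℝ) : Prog X n (Fin n → ℝ) :=
  fill g (fun _ => 0) (List.finRange n)

/-- Count the data points `x` with `H_i(x) < H_j(x)`. -/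
def countLess {X : Type u} {n : ℕ} (i j : Fin n) : List X → Prog X n ℝ
  | [] => pure 0
  | x :: xs => do
      let c ← countLess i j xs
      let b ← askLess i j x
      op (if b then c + 1 else c)

/-- The empirical semi-distance `ŵ_i(H_j) = |H_j(S_{i,j}) - P̂(S_{i,j})|`. -/
def empSemiDist {X : Type u} {n s : ℕ} (D : Fin s → X) (i j : Fin n) : Prog X n ℝ := do
  let c ← countLess (min i j) (max i j) (List.ofFn D)
  let p ← op (c / s)
  let m ← askMass j i
  op |m - p|

/-- Insert into a non-increasing list. -/
def insertDesc {X : Type u} {n : ℕ} (x : ℝ) : List ℝ → Prog X n (List ℝ)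
  | [] => op [x]
  | y :: ys => do
      let b ← op (decide (y ≤ x))
      if b then op (x :: y :: ys)
      else do
        let zs ← insertDesc x ys
        op (y :: zs)

/-- Sort in non-increasing order. -/
def sortDesc {X : Type u} {n : ℕ} : List ℝ → Prog X n (List ℝ)
  | [] => pure []
  | x :: xs => do
      let ys ← sortDesc xs
      insertDesc x ys

/-- The lift values `ŵ_i(H_j) - W̃(H_j)` for the hypotheses `H_j` of a list. -/
def liftValues {X : Type u} {n s : ℕ} (D : Fin s → X) (W : Fin n → ℝ) (i : Fin n) :
    List (Fin n) → Prog X n (List ℝ)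
  | [] => pure []
  | j :: js => do
      let w ← empSemiDist D i j
      let v ← op (w - W j)
      let vs ← liftValues D W i js
      op (v :: vs)

/-- COMPUTE-SCORE: the `⌈(η/2)|K|⌉`-th largest lift value that `H_i` induces on the list `K`. -/
def computeScore {X : Type u} {n s : ℕ} (η : ℝ) (K : List (Fin n)) (W : Fin n → ℝ)
    (D : Fin s → X) (i : Fin n) : Prog X n ℝ := do
  let L ← liftValues D W i K
  let L' ← sortDesc L
  op (L'.getD (⌈η / 2 * K.length⌉₊ - 1) 0)

/-- The loop of FIND-PROMPTING-HYPOTHESIS over a list of hypotheses, with noisy threshold `τ` and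
noise scale `b`. -/
def scan {X : Type u} {n s : ℕ} (b τ η : ℝ) (K : List (Fin n)) (W : Fin n → ℝ) (D : Fin s → X) :
    List (Fin n) → Prog X n (Option (Fin n))
  | [] => op none
  | i :: R => do
      let ν ← drawLaplace b
      let sc ← computeScore η K W D i
      let above ← op (decide (τ ≤ sc + ν))
      if above then op (some i) else scan b τ η K W D R

/-- FIND-PROMPTING-HYPOTHESIS, by the sparse vector technique, among the hypotheses in `R`;
`none` stands for `⊥`. -/
def findPrompting {X : Type u} {n s : ℕ} (ε Δ σ' η : ℝ) (R K : List (Fin n)) (W : Fin n → ℝ)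
    (D : Fin s → X) : Prog X n (Option (Fin n)) := do
  let ε₁ ← op (ε / 2)
  let ε₂ ← op (ε - ε₁)
  let ρ ← drawLaplace (Δ / ε₁)
  let τ ← op (3 * σ' / 4)
  let τ' ← op (τ + ρ)
  scan (2 * Δ / ε₂) τ' η K W D R

/-- Weights proportional to the distribution `Q` of the exponential mechanism for the proxy
distances `W`, which have sensitivity `Δ`. -/
def expWeights {X : Type u} {n : ℕ} (ε Δ : ℝ) (W : Fin n → ℝ) : Prog X n (Fin n → ℝ) :=
  tabulate fun j => op (Real.exp (-(ε * W j / (2 * Δ))))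

/-- Draw a list of `k` independent indices. -/
def drawList {X : Type u} {n : ℕ} (w : Fin n → ℝ) : ℕ → Prog X n (List (Fin n))
  | 0 => pure []
  | k + 1 => do
      let j ← drawIndex w
      let js ← drawList w k
      op (j :: js)

/-- The members of a list that are not in the prompting set `A`. -/
def remaining {X : Type u} {n : ℕ} (A : Finset (Fin n)) : List (Fin n) → Prog X n (List (Fin n))
  | [] => pure []
  | i :: R => do
      let R' ← remaining A R
      op (if i ∈ A then R' else i :: R')

/-- At most `t` rounds of the main loop, started with prompting set `A` and proxy distances `W`;
returns the final proxy distances. -/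
def rounds {X : Type u} {n s : ℕ} (εE εS σ β : ℝ) (k : ℕ) (D : Fin s → X) :
    ℕ → Finset (Fin n) → (Fin n → ℝ) → Prog X n (Fin n → ℝ)
  | 0, _, W => pure W
  | t + 1, A, W => do
      let Q ← expWeights εE (1 / s) W
      let K ← drawList Q k
      let R ← remaining A (List.finRange n)
      let r ← findPrompting εS (2 / s) (σ / 4) (β / 4) R K W D
      match r with
      | none => pure W
      | some i => do
          let A' ← op (insert i A)
          let W' ← tabulate fun j => do
            let w ← empSemiDist D i j
            op (max (W j) w)
          rounds εE εS σ β k D t A' W'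

/-- SELECT-HYPOTHESIS on the data set `D` of `s` samples (one step is charged per sample), with at
most `T` rounds and lists of `k` hypotheses. The output is drawn by the exponential mechanism for
the proxy distances held when the loop ends. -/
def selectHypothesis {X : Type u} (n s T k : ℕ) (ε β σ : ℝ) (D : Fin s → X) :
    Prog X n (Fin n) := do
  let εE ← op (ε / (2 * (k * T + 1)))
  let εS ← op (ε / (2 * T))
  steps s
  let W₀ ← tabulate fun _ => op 0
  let W ← rounds εE εS σ β k D T ∅ W₀
  let Q ← expWeights εE (1 / s) W
  drawIndex Q

/-! ### Parameters and guarantees -/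

/-- `log³(n/β) / (β²σ²ε)`. -/
def sampleRate (n : ℕ) (ε β σ : ℝ) : ℝ :=
  Real.log (n / β) ^ 3 / (β ^ 2 * σ ^ 2 * ε)

/-- `min(n log⁵(n/β) / (β⁴σ³ε), n² log⁴(n/β) / (β³σ²ε))`. -/
def timeRate (n : ℕ) (ε β σ : ℝ) : ℝ :=
  min (n * Real.log (n / β) ^ 5 / (β ^ 4 * σ ^ 3 * ε))
    (n ^ 2 * Real.log (n / β) ^ 4 / (β ^ 3 * σ ^ 2 * ε))

/-- The number of samples `s`. -/
def numSamples (c : ℝ) (n : ℕ) (ε β σ : ℝ) : ℕ :=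
  ⌈c * sampleRate n ε β σ⌉₊

/-- The maximal number of rounds `T`. -/
def numRounds (c : ℝ) (n : ℕ) (β σ : ℝ) : ℕ :=
  min ⌈c * (Real.log (n / β) / (β * σ))⌉₊ n

/-- The length `k` of the sampled lists of hypotheses. -/
def listSize (c : ℝ) (n : ℕ) (β : ℝ) : ℕ :=
  ⌈c * (Real.log (n / β) / β)⌉₊

/-- The algorithm, with implied constants `cs`, `cT`, `ck` in its parameters. -/
def algorithm {X : Type u} (cs cT ck : ℝ) (n : ℕ) (ε β σ : ℝ)
    (D : Fin (numSamples cs n ε β σ) → X) : Prog X n (Fin n) :=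
  selectHypothesis n (numSamples cs n ε β σ) (numRounds cT n β σ) (listSize ck n β) ε β σ D

/-- The program `A`, run on data sets of `s` points with queries answered according to `H`, is an
`(α, ε, β, σ)`-proper learner for private hypothesis selection: it is `ε`-differentially private,
and for every distribution `P`, on `s` independent samples from `P`, its output is an index `i` with
`‖H_i - P‖_TV ≤ α · OPT + σ` with probability at least `1 - β`. -/
structure IsPrivateProperLearner {X : Type u} [MeasurableSpace X] {n s : ℕ} (α ε β σ : ℝ)
    (H : HypothesisClass X n) (A : (Fin s → X) → Prog X n (Fin n)) : Prop where
  dp : ∀ D D' : Fin s → X, {l | D l ≠ D' l}.ncard = 1 → ∀ S : Set (Fin n),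
    (A D).prob H (fun i _ => i ∈ S) ≤
      ENNReal.ofReal (Real.exp ε) * (A D').prob H (fun i _ => i ∈ S)
  accurate : ∀ P : Measure X, IsProbabilityMeasure P →
    ENNReal.ofReal (1 - β) ≤
      ∫⁻ D, (A D).prob H (fun i _ => tvDist (H.law i) P ≤ α * H.opt P + σ)
        ∂(Measure.pi fun _ : Fin s => P)

end HypSel

end

/-!
The proof treats the four guarantees with one small calculus for `Prog`. Whatever the data decide is
deterministic (`Prog.Evals`), so a program is a chain of noisy comparisons and draws of indices.
`Prog.mean` is the expectation of a function of the result. The Laplace integrals in it are defined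
for arbitrary integrands; since the outcome of a noisy comparison depends monotonically on the
threshold, they are integrals of measurable functions here, and expectations are additive
(`Prog.IsProb`).

*Privacy.* Changing one data point changes every empirical semi-distance and hence every proxy
distance by at most `1 / s`, and every score by at most `2 / s`. The two runs are compared with
proxy distances that are `1 / s`-close: a draw by the exponential mechanism then costs a factor
`e ^ εE`, and the sparse vector technique costs `e ^ εS`, because translating the threshold noise
protects all answers below the threshold and translating a single score noise protects the one above
it (`mean_scan_le`, `mean_rounds_le`). The losses add up to `ε`.

*Accuracy.* Let `H_{i₀}` be a closest hypothesis. By the Scheffé inequality (`tvDist_law_le`) it is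
enough that the output has a proxy distance close to the smallest one and is not refuted by `H_{i₀}`
by much more than its proxy distance. The exponential mechanism gives the first. For the second, a
round without a prompting hypothesis certifies, by a Chernoff bound for the list `K`, that only a
small mass of hypotheses is refuted by `H_{i₀}` (`IsSettled`). A round with a prompting hypothesis
raises the proxy distances of a mass of at least `β / 16`, which multiplies the normalizing constant
`∑ j, exp (-λ W j)`, `λ = εE s / 2`, by at most `1 - β / 32` (`sum_gibbs_update_le`). The constant
starts at `n` and stays at least `exp (-λ)`, since no proxy distance exceeds `1`. So the loop cannot
go on for `T` rounds, unless `T = n` and every hypothesis has become prompting, `H_{i₀}` included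
(`mean_rounds_le_add`). The failure probabilities are `β / 4` for the sample (Hoeffding), `β / (4 n)`
for each of the at most `n` rounds, and `β / 2` for the output.

*Running time.* All lists have bounded length, which bounds every run (`Prog.Ensures`). Conversely,
Laplace noise can make the last remaining hypothesis the prompting one in each round; this run has
positive probability (`Prog.CanTake`) and computes at least `n T / 2` scores, from `k` semi-distances
each (`canTake_rounds`).
-/

noncomputable section

namespace HypSel

open Prog ProbabilityTheory

variable {X : Type u} [MeasurableSpace X] {n : ℕ} {H : HypothesisClass X n}

/-! ### Calculus of programs -/

namespace Prog

variable {α β : Type}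

theorem expect_bind (H : HypothesisClass X n) (p : Prog X n α) (g : α → Prog X n β)
    (f : β → ℕ → ℝ≥0∞) :
    (p >>= g).expect H f = p.expect H fun a t => (g a).expect H fun b u => f b (t + u) := by
  change (p.bind g).expect H f = _
  induction p generalizing f with
  | ret a => simp [Prog.bind, expect]
  | step p ih => simp only [Prog.bind, expect, ih, add_right_comm]
  | less i j x k ih => simp only [Prog.bind, expect, ih, add_right_comm]
  | mass i j k ih => simp only [Prog.bind, expect, ih, add_right_comm]
  | laplace b k ih => simp only [Prog.bind, expect, ih, add_right_comm]
  | draw w k ih => simp only [Prog.bind, expect, ih, add_right_comm]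

theorem expect_mono (H : HypothesisClass X n) (p : Prog X n α) {f g : α → ℕ → ℝ≥0∞}
    (h : ∀ a t, f a t ≤ g a t) : p.expect H f ≤ p.expect H g := by
  induction p generalizing f g with
  | ret a => exact h _ _
  | step p ih => exact ih fun a t => h _ _
  | less i j x k ih => exact ih _ fun a t => h _ _
  | mass i j k ih => exact ih _ fun a t => h _ _
  | laplace b k ih => exact lintegral_mono fun r => ih r fun a t => h _ _
  | draw w k ih =>
    exact Finset.sum_le_sum fun j _ => mul_le_mul_right (ih j fun a t => h _ _) _

@[simp] theorem expect_pure (a : α) (f : α → ℕ → ℝ≥0∞) :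
    (pure a : Prog X n α).expect H f = f a 0 := rfl

@[simp] theorem expect_op (a : α) (f : α → ℕ → ℝ≥0∞) :
    (op a : Prog X n α).expect H f = f a 1 := rfl

@[simp] theorem expect_askLess (i j : Fin n) (x : X) (f : Bool → ℕ → ℝ≥0∞) :
    (askLess i j x).expect H f = f (decide (H.pdf i x < H.pdf j x)) 1 := rfl

@[simp] theorem expect_askMass (i j : Fin n) (f : ℝ → ℕ → ℝ≥0∞) :
    (askMass i j : Prog X n ℝ).expect H f = f ((H.law i).real (H.scheffe i j)) 1 := rfl

@[simp] theorem expect_drawLaplace (b : ℝ) (f : ℝ → ℕ → ℝ≥0∞) :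
    (drawLaplace b : Prog X n ℝ).expect H f = ∫⁻ r, f r 1 ∂(HypSel.laplace b) := by
  simp [drawLaplace, expect]

@[simp] theorem expect_drawIndex (w : Fin n → ℝ) (f : Fin n → ℕ → ℝ≥0∞) :
    (drawIndex w : Prog X n (Fin n)).expect H f =
      ∑ j, ENNReal.ofReal (w j / ∑ i, w i) * f j n := by
  simp [drawIndex, expect]

/-- The program is deterministic when the queries are answered by `H`: it returns `v` after exactly
`c` steps. -/
def Evals (H : HypothesisClass X n) (p : Prog X n α) (v : α) (c : ℕ) : Prop :=
  ∀ f, p.expect H f = f v c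

theorem Evals.pure (a : α) : Evals H (Pure.pure a : Prog X n α) a 0 := fun _ => rfl

theorem Evals.op (a : α) : Evals H (op a : Prog X n α) a 1 := fun _ => rfl

theorem Evals.bind {p : Prog X n α} {g : α → Prog X n β} {a : α} {b : β} {c d : ℕ}
    (hp : Evals H p a c) (hg : Evals H (g a) b d) : Evals H (p >>= g) b (c + d) := fun f => by
  rw [expect_bind, hp, hg]

/-- Almost surely the result satisfies `P` and the number of steps is at most `B`. It is stated
through the test functions that vanish on all such outcomes, which needs no measurability. -/
def Ensures (H : HypothesisClass X n) (p : Prog X n α) (P : α → Prop) (B : ℕ) : Prop :=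
  ∀ f : α → ℕ → ℝ≥0∞, (∀ a t, P a → t ≤ B → f a t = 0) → p.expect H f = 0

theorem Ensures.bind {p : Prog X n α} {g : α → Prog X n β} {P : α → Prop} {Q : β → Prop} {B C : ℕ}
    (hp : Ensures H p P B) (hg : ∀ a, P a → Ensures H (g a) Q C) :
    Ensures H (p >>= g) Q (B + C) := fun f hf => by
  rw [expect_bind]
  exact hp _ fun a t ha ht => hg a ha _ fun b u hb hu => hf _ _ hb (by omega)

theorem Ensures.mono {p : Prog X n α} {P Q : α → Prop} {B C : ℕ} (hp : Ensures H p P B)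
    (hPQ : ∀ a, P a → Q a) (hBC : B ≤ C) : Ensures H p Q C :=
  fun f hf => hp f fun a t ha ht => hf a t (hPQ a ha) (ht.trans hBC)

theorem Evals.ensures {p : Prog X n α} {a : α} {c B : ℕ} {P : α → Prop} (hp : Evals H p a c)
    (ha : P a) (hc : c ≤ B) : Ensures H p P B := fun f hf => by
  rw [hp]; exact hf _ _ ha hc

theorem Ensures.op {a : α} {P : α → Prop} (ha : P a) : Ensures H (Prog.op a : Prog X n α) P 1 :=
  (Evals.op a).ensures ha le_rfl

theorem Ensures.op_true (a : α) : Ensures H (Prog.op a : Prog X n α) (fun _ => True) 1 :=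
  Ensures.op trivial

theorem Ensures.drawLaplace (b : ℝ) :
    Ensures H (drawLaplace b : Prog X n ℝ) (fun _ => True) 1 := fun f hf => by
  simp [hf _ 1 trivial le_rfl]

theorem Ensures.drawIndex (w : Fin n → ℝ) :
    Ensures H (drawIndex w : Prog X n (Fin n)) (fun _ => True) n := fun f hf => by
  simp [hf _ n trivial le_rfl]

/-- With positive probability the program returns `a` after exactly `c` steps. -/
def CanTake (H : HypothesisClass X n) (p : Prog X n α) (a : α) (c : ℕ) : Prop :=
  ∃ q : ℝ≥0∞, 0 < q ∧ ∀ f, q * f a c ≤ p.expect H f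

theorem Evals.canTake {p : Prog X n α} {a : α} {c : ℕ} (hp : Evals H p a c) : CanTake H p a c :=
  ⟨1, one_pos, fun f => by rw [one_mul, hp]⟩

theorem CanTake.bind {p : Prog X n α} {g : α → Prog X n β} {a : α} {b : β} {c d : ℕ}
    (hp : CanTake H p a c) (hg : CanTake H (g a) b d) : CanTake H (p >>= g) b (c + d) := by
  obtain ⟨q, hq, hp⟩ := hp
  obtain ⟨r, hr, hg⟩ := hg
  refine ⟨q * r, ENNReal.mul_pos hq.ne' hr.ne', fun f => ?_⟩
  rw [expect_bind, mul_assoc]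
  exact (mul_le_mul_right (hg fun b u => f b (c + u)) q).trans
    (hp fun a t => (g a).expect H fun b u => f b (t + u))

/-- The expectation of a function of the result. -/
def mean (H : HypothesisClass X n) (p : Prog X n α) (φ : α → ℝ≥0∞) : ℝ≥0∞ :=
  p.expect H fun a _ => φ a

theorem mean_bind (p : Prog X n α) (g : α → Prog X n β) (φ : β → ℝ≥0∞) :
    mean H (p >>= g) φ = mean H p fun a => mean H (g a) φ :=
  expect_bind H p g _

theorem mean_mono (p : Prog X n α) {φ ψ : α → ℝ≥0∞} (h : ∀ a, φ a ≤ ψ a) :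
    mean H p φ ≤ mean H p ψ :=
  expect_mono H p fun a _ => h a

theorem Evals.mean_eq {p : Prog X n α} {a : α} {c : ℕ} (hp : Evals H p a c) (φ : α → ℝ≥0∞) :
    mean H p φ = φ a :=
  hp _

theorem Evals.mean_bind {p : Prog X n α} {a : α} {c : ℕ} (hp : Evals H p a c)
    (g : α → Prog X n β) (φ : β → ℝ≥0∞) : mean H (p >>= g) φ = mean H (g a) φ := by
  rw [Prog.mean_bind, hp.mean_eq]

@[simp] theorem mean_pure (a : α) (φ : α → ℝ≥0∞) : mean H (pure a : Prog X n α) φ = φ a := rfl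

@[simp] theorem mean_op (a : α) (φ : α → ℝ≥0∞) : mean H (op a : Prog X n α) φ = φ a := rfl

theorem mean_drawLaplace (b : ℝ) (φ : ℝ → ℝ≥0∞) :
    mean H (drawLaplace b : Prog X n ℝ) φ = ∫⁻ r, φ r ∂(HypSel.laplace b) :=
  expect_drawLaplace b _

theorem mean_drawIndex (w : Fin n → ℝ) (φ : Fin n → ℝ≥0∞) :
    mean H (drawIndex w : Prog X n (Fin n)) φ = ∑ j, ENNReal.ofReal (w j / ∑ i, w i) * φ j :=
  expect_drawIndex w _

/-- The results of the program have a probability distribution: the expectation is additive and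
fixes the constants. As the integrals over Laplace noise are defined for arbitrary integrands, this
is not automatic. -/
structure IsProb (H : HypothesisClass X n) (p : Prog X n α) : Prop where
  add : ∀ φ ψ : α → ℝ≥0∞, mean H p (fun a => φ a + ψ a) = mean H p φ + mean H p ψ
  const : ∀ M : ℝ≥0∞, mean H p (fun _ => M) = M

theorem Evals.isProb {p : Prog X n α} {a : α} {c : ℕ} (hp : Evals H p a c) : IsProb H p :=
  ⟨fun φ ψ => by simp only [hp.mean_eq], fun _ => hp.mean_eq _⟩

theorem IsProb.bind {p : Prog X n α} {g : α → Prog X n β} (hp : IsProb H p)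
    (hg : ∀ a, IsProb H (g a)) : IsProb H (p >>= g) := by
  refine ⟨fun φ ψ => ?_, fun M => ?_⟩
  · simp only [Prog.mean_bind, (hg _).add, hp.add]
  · simp only [Prog.mean_bind, (hg _).const, hp.const]

theorem IsProb.mean_le_one {p : Prog X n α} (hp : IsProb H p) {φ : α → ℝ≥0∞}
    (h : ∀ a, φ a ≤ 1) : mean H p φ ≤ 1 :=
  (mean_mono p h).trans (hp.const 1).le

theorem IsProb.mean_sum {p : Prog X n α} (hp : IsProb H p) {ι : Type*} (s : Finset ι)
    (φ : ι → α → ℝ≥0∞) : mean H p (fun a => ∑ i ∈ s, φ i a) = ∑ i ∈ s, mean H p (φ i) := by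
  classical
  induction s using Finset.induction_on with
  | empty => simpa using hp.const 0
  | insert i s hi ih => simp only [Finset.sum_insert hi, hp.add, ih]

open Classical in
/-- If the results that satisfy `P` but not `E` contribute at most `M` each, then the expectation
exceeds `M` by at most the probability of `E`. -/
theorem IsProb.mean_le_add {p : Prog X n α} (hp : IsProb H p) {P : α → Prop} {B : ℕ}
    (hP : Ensures H p P B) (E : α → Prop) {φ : α → ℝ≥0∞} {M : ℝ≥0∞} (hφ : ∀ a, φ a ≤ 1)
    (h : ∀ a, P a → ¬ E a → φ a ≤ M) :
    mean H p φ ≤ mean H p (fun a => if E a then 1 else 0) + M := by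
  have h0 : mean H p (fun a => if P a then 0 else 1) = 0 := hP _ fun a _ ha _ => by simp [ha]
  calc mean H p φ ≤ mean H p fun a => ((if E a then 1 else 0) + M) + (if P a then 0 else 1) :=
        mean_mono p fun a => by
          by_cases hE : E a
          · simp only [hE, if_true, add_assoc]
            exact (hφ a).trans le_self_add
          · by_cases hPa : P a
            · simpa [hE, hPa] using h a hPa hE
            · simp only [hPa, if_false]
              exact (hφ a).trans le_add_self
    _ = _ := by rw [hp.add, hp.add, hp.const, h0, add_zero]

theorem IsProb.drawIndex {w : Fin n → ℝ} (h0 : ∀ j, 0 ≤ w j) (h : 0 < ∑ j, w j) :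
    IsProb H (drawIndex w : Prog X n (Fin n)) := by
  refine ⟨fun φ ψ => ?_, fun M => ?_⟩
  · simp only [mean_drawIndex, mul_add, Finset.sum_add_distrib]
  · rw [mean_drawIndex, ← Finset.sum_mul, ← ENNReal.ofReal_sum_of_nonneg fun j _ => div_nonneg (h0 j) h.le, ← Finset.sum_div,
      div_self h.ne', ENNReal.ofReal_one, one_mul]

theorem CanTake.drawIndex {w : Fin n → ℝ} (h0 : ∀ j, 0 < w j) (j : Fin n) :
    CanTake H (drawIndex w : Prog X n (Fin n)) j n := by
  refine ⟨ENNReal.ofReal (w j / ∑ i, w i), ?_, fun f => ?_⟩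
  · exact ENNReal.ofReal_pos.2 (div_pos (h0 j) (Finset.sum_pos (fun i _ => h0 i) ⟨j, by simp⟩))
  · rw [expect_drawIndex]
    exact Finset.single_le_sum (f := fun j => ENNReal.ofReal (w j / ∑ i, w i) * f j n)
      (fun _ _ => zero_le) (Finset.mem_univ j)

end Prog

/-! ### Deterministic parts of the algorithm -/

/-- The value of the empirical semi-distance `ŵ_i(H_j)` on the data set `D`. -/
def semiDist (H : HypothesisClass X n) {s : ℕ} (D : Fin s → X) (i j : Fin n) : ℝ :=
  |(H.law j).real (H.scheffe i j) - (∑ l, (H.scheffe i j).indicator 1 (D l)) / s|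

/-- The value of the score of `H_i` on the list `K`: an order statistic of the lift values. -/
def scoreValue (H : HypothesisClass X n) {s : ℕ} (η : ℝ) (K : List (Fin n)) (W : Fin n → ℝ)
    (D : Fin s → X) (i : Fin n) : ℝ :=
  ((K.map fun j => semiDist H D i j - W j).insertionSort (· ≥ ·)).getD
    (⌈η / 2 * K.length⌉₊ - 1) 0

theorem scheffe_comm (H : HypothesisClass X n) (i j : Fin n) : H.scheffe i j = H.scheffe j i := by
  simp only [HypothesisClass.scheffe, min_comm, max_comm]

theorem evals_countLess (i j : Fin n) (xs : List X) :
    Evals H (countLess (min i j) (max i j) xs)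
      (xs.map ((H.scheffe i j).indicator (1 : X → ℝ))).sum (2 * xs.length) := by
  classical
  intro f
  induction xs generalizing f with
  | nil => rfl
  | cons x xs ih =>
    simp only [countLess, expect_bind, ih, expect_askLess, expect_op]
    congr 1
    simp only [List.map_cons, List.sum_cons, Set.indicator_apply, HypothesisClass.scheffe,
      Set.mem_ofPred_eq, Pi.one_apply, decide_eq_true_eq]
    split_ifs <;> ring

theorem evals_empSemiDist {s : ℕ} (D : Fin s → X) (i j : Fin n) :
    Evals H (empSemiDist D i j) (semiDist H D i j) (2 * s + 3) := by
  intro f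
  simp only [empSemiDist, expect_bind, evals_countLess i j _ _, expect_op, expect_askMass]
  congr 1
  · rw [semiDist, scheffe_comm H j i, List.map_ofFn, List.sum_ofFn]; rfl
  · simp

theorem evals_fill {g : Fin n → Prog X n ℝ} {v : Fin n → ℝ} {c : ℕ}
    (h : ∀ j, Evals H (g j) (v j) c) (a : Fin n → ℝ) (js : List (Fin n)) :
    Evals H (fill g a js) (fun j => if j ∈ js then v j else a j) (js.length * c) := by
  intro f
  induction js generalizing a f with
  | nil => simp [fill]
  | cons j js ih =>
    simp only [fill, expect_bind, h j _, ih]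
    congr 1
    · funext i
      by_cases hi : i ∈ js
      · simp [hi]
      · by_cases hij : i = j
        · subst hij; simp [hi]
        · simp [hi, hij]
    · simp; ring

theorem evals_tabulate {g : Fin n → Prog X n ℝ} {v : Fin n → ℝ} {c : ℕ}
    (h : ∀ j, Evals H (g j) (v j) c) : Evals H (tabulate g) v (n * c) := by
  simpa [tabulate] using evals_fill h (fun _ => 0) (List.finRange n)

theorem evals_liftValues {s : ℕ} (D : Fin s → X) (W : Fin n → ℝ) (i : Fin n) (K : List (Fin n)) :
    Evals H (liftValues D W i K) (K.map fun j => semiDist H D i j - W j)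
      (K.length * (2 * s + 5)) := by
  intro f
  induction K generalizing f with
  | nil => simp [liftValues]
  | cons j js ih =>
    simp only [liftValues, expect_bind, evals_empSemiDist D i j _, expect_op, ih]
    congr 1
    simp; ring

theorem evals_insertDesc (x : ℝ) (ys : List ℝ) :
    ∃ c ≤ 2 * ys.length + 2, Evals H (insertDesc x ys : Prog X n (List ℝ))
      (ys.orderedInsert (· ≥ ·) x) c := by
  induction ys with
  | nil => exact ⟨1, by simp, fun f => by simp [insertDesc]⟩
  | cons y ys ih =>
    obtain ⟨c, hc, ih⟩ := ih
    by_cases h : y ≤ x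
    · exact ⟨2, by simp, fun f => by simp [insertDesc, expect_bind, h]⟩
    · refine ⟨c + 2, by simp; omega, fun f => ?_⟩
      simp [insertDesc, expect_bind, h, ih _]
      congr 1; ring

theorem evals_sortDesc (L : List ℝ) :
    ∃ c ≤ L.length * (2 * L.length + 2), Evals H (sortDesc L : Prog X n (List ℝ))
      (L.insertionSort (· ≥ ·)) c := by
  induction L with
  | nil => exact ⟨0, by simp, fun f => rfl⟩
  | cons x xs ih =>
    obtain ⟨c, hc, ih⟩ := ih
    obtain ⟨d, hd, hi⟩ := evals_insertDesc (H := H) x (xs.insertionSort (· ≥ ·))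
    rw [List.length_insertionSort] at hd
    refine ⟨c + d, ?_, ih.bind hi⟩
    simp only [List.length_cons]
    nlinarith

/-- The number of steps of a score computation depends on the data through the sorting only. -/
theorem evals_computeScore {s : ℕ} (η : ℝ) (K : List (Fin n)) (W : Fin n → ℝ) (D : Fin s → X)
    (i : Fin n) :
    ∃ c, K.length * s ≤ c ∧ c ≤ K.length * (2 * s + 2 * K.length + 7) + 1 ∧
      Evals H (computeScore η K W D i) (scoreValue H η K W D i) c := by
  obtain ⟨c, hc, hs⟩ :=
    evals_sortDesc (H := H) (K.map fun j => semiDist H D i j - W j)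
  rw [List.length_map] at hc
  refine ⟨K.length * (2 * s + 5) + (c + 1), by nlinarith, by nlinarith,
    (evals_liftValues D W i K).bind (hs.bind (Evals.op _))⟩

theorem evals_expWeights (ε Δ : ℝ) (W : Fin n → ℝ) :
    Evals H (expWeights ε Δ W : Prog X n (Fin n → ℝ))
      (fun j => Real.exp (-(ε * W j / (2 * Δ)))) n := by
  have h := evals_tabulate (H := H) fun j => Evals.op (Real.exp (-(ε * W j / (2 * Δ))))
  rw [mul_one] at h
  exact h

theorem evals_remaining (A : Finset (Fin n)) (R : List (Fin n)) :
    Evals H (remaining A R : Prog X n (List (Fin n))) (R.filter (· ∉ A)) R.length := by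
  intro f
  induction R generalizing f with
  | nil => rfl
  | cons i R ih =>
    simp only [remaining, expect_bind, ih, expect_op]
    congr 1
    by_cases hi : i ∈ A <;> simp [hi]

theorem evals_update {s : ℕ} (D : Fin s → X) (W : Fin n → ℝ) (i : Fin n) :
    Evals H (tabulate fun j => do
        let w ← empSemiDist D i j
        op (max (W j) w)) (fun j => max (W j) (semiDist H D i j)) (n * (2 * s + 4)) :=
  evals_tabulate fun j => Evals.bind (c := 2 * s + 3) (d := 1) (evals_empSemiDist D i j)
    (Evals.op (max (W j) (semiDist H D i j)))

theorem evals_steps (m : ℕ) : Evals H (steps m : Prog X n Unit) () m := by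
  intro f
  induction m generalizing f with
  | zero => rfl
  | succ m ih => simp [steps, expect, ih]

/-- The rank `m` entry of the decreasing rearrangement is at least `a` exactly when more than `m`
entries are. -/
theorem le_getD_insertionSort_iff (L : List ℝ) {m : ℕ} (hm : m < L.length) (a : ℝ) :
    a ≤ (L.insertionSort (· ≥ ·)).getD m 0 ↔ m + 1 ≤ L.countP fun x => decide (a ≤ x) := by
  rw [← (List.perm_insertionSort (· ≥ ·) L).countP_eq]
  rw [← List.length_insertionSort (· ≥ ·) L] at hm
  have hs := List.pairwise_insertionSort (· ≥ ·) L
  generalize L.insertionSort (· ≥ ·) = l at hm hs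
  induction l generalizing m with
  | nil => simp at hm
  | cons x xs ih =>
    rw [List.pairwise_cons] at hs
    rw [List.countP_cons]
    have hx : 1 ≤ xs.countP (fun x => decide (a ≤ x)) → a ≤ x := fun h => by
      obtain ⟨y, hy, hay⟩ := List.countP_pos_iff.1 h
      exact (of_decide_eq_true hay).trans (hs.1 y hy)
    cases m with
    | zero =>
      by_cases h : a ≤ x
      · simp [h]
      · have := mt hx h
        simp [h] at this ⊢
        omega
    | succ m =>
      have := ih (m := m) (by simpa using hm) hs.2
      rw [List.getD_cons_succ]
      refine this.trans ?_
      by_cases h : a ≤ x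
      · simp [h]
      · have := mt hx h
        simp only [h]
        simp
        omega

/-! ### Laplace noise -/

/-- The density of the Laplace distribution. -/
def laplacePDF (b x : ℝ) : ℝ≥0∞ :=
  ENNReal.ofReal (Real.exp (-|x| / b) / (2 * b))

theorem measurable_laplacePDF (b : ℝ) : Measurable (laplacePDF b) := by
  unfold laplacePDF; fun_prop

theorem laplace_eq (b : ℝ) : laplace b = volume.withDensity (laplacePDF b) := rfl

theorem lintegral_laplace (b : ℝ) (h : ℝ → ℝ≥0∞) :
    ∫⁻ r, h r ∂(laplace b) = ∫⁻ r, laplacePDF b r * h r := by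
  rw [laplace_eq, lintegral_withDensity_eq_lintegral_mul_non_measurable _ (measurable_laplacePDF b)
    (Filter.Eventually.of_forall fun x => ENNReal.ofReal_lt_top)]
  rfl

theorem isProbabilityMeasure_laplace {b : ℝ} (hb : 0 < b) : IsProbabilityMeasure (laplace b) := by
  refine ⟨?_⟩
  rw [laplace_eq, withDensity_apply _ MeasurableSet.univ, Measure.restrict_univ]
  have hI : ∫ x : ℝ, Real.exp (-|x| / b) / (2 * b) = 1 := by
    have heq : (fun x : ℝ => Real.exp (-|x| / b) / (2 * b)) =
        fun x => (fun y => Real.exp (-b⁻¹ * y) / (2 * b)) |x| := by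
      funext x; simp only; congr 2; field_simp
    rw [heq, integral_comp_abs (f := fun y => Real.exp (-b⁻¹ * y) / (2 * b)), integral_div,
      integral_exp_mul_Ioi (neg_lt_zero.2 (inv_pos.2 hb)), mul_zero, Real.exp_zero]
    field_simp
  have hint : Integrable fun x : ℝ => Real.exp (-|x| / b) / (2 * b) := by
    by_contra h
    rw [integral_undef h] at hI
    exact zero_ne_one hI
  unfold laplacePDF
  rw [← ofReal_integral_eq_lintegral_ofReal hint
    (Filter.Eventually.of_forall fun x => by positivity), hI, ENNReal.ofReal_one]

/-- Translating Laplace noise changes probabilities by a bounded factor. The test function need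
not be measurable. -/
theorem lintegral_laplace_add_le {b δ : ℝ} (hb : 0 < b) (hδ : 0 ≤ δ) (h : ℝ → ℝ≥0∞) :
    ∫⁻ r, h (r + δ) ∂(laplace b) ≤
      ENNReal.ofReal (Real.exp (δ / b)) * ∫⁻ r, h r ∂(laplace b) := by
  rw [lintegral_laplace, lintegral_laplace, ← lintegral_const_mul' _ _ ENNReal.ofReal_ne_top]
  rw [← lintegral_add_right_eq_self
    (fun r => ENNReal.ofReal (Real.exp (δ / b)) * (laplacePDF b r * h r)) δ]
  refine lintegral_mono fun r => ?_
  simp only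
  rw [← mul_assoc]
  refine mul_le_mul_left ?_ _
  rw [laplacePDF, laplacePDF, ← ENNReal.ofReal_mul (Real.exp_pos _).le, ← mul_div_assoc,
    ← Real.exp_add]
  refine ENNReal.ofReal_le_ofReal ?_
  gcongr
  rw [← add_div]
  have := abs_add_le r δ
  rw [abs_of_nonneg hδ] at this
  gcongr
  linarith

theorem laplace_Ioi_le {b t : ℝ} (hb : 0 < b) (ht : 0 ≤ t) :
    laplace b (Set.Ioi t) ≤ ENNReal.ofReal (Real.exp (-t / b)) := by
  have := isProbabilityMeasure_laplace hb
  calc laplace b (Set.Ioi t) = ∫⁻ x in Set.Ioi t, laplacePDF b x := by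
        rw [laplace_eq, withDensity_apply _ measurableSet_Ioi]
    _ ≤ ∫⁻ x, ENNReal.ofReal (Real.exp (-t / b)) * laplacePDF b (x - t) := by
        refine (setLIntegral_mono' measurableSet_Ioi fun x hx => ?_).trans
          (setLIntegral_le_lintegral _ _)
        have hx : t < x := hx
        rw [laplacePDF, laplacePDF, ← ENNReal.ofReal_mul (Real.exp_pos _).le, ← mul_div_assoc,
          ← Real.exp_add, ← add_div, abs_of_pos (ht.trans_lt hx), abs_of_pos (sub_pos.2 hx)]
        refine ENNReal.ofReal_le_ofReal (le_of_eq ?_)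
        congr 3; ring
    _ = ENNReal.ofReal (Real.exp (-t / b)) * laplace b Set.univ := by
        rw [lintegral_const_mul' _ _ ENNReal.ofReal_ne_top,
          lintegral_sub_right_eq_self (laplacePDF b) t, laplace_eq,
          withDensity_apply _ MeasurableSet.univ, Measure.restrict_univ]
    _ = _ := by rw [measure_univ, mul_one]

theorem laplace_Iio_le {b t : ℝ} (hb : 0 < b) (ht : 0 ≤ t) :
    laplace b (Set.Iio (-t)) ≤ ENNReal.ofReal (Real.exp (-t / b)) := by
  refine le_trans (le_of_eq ?_) (laplace_Ioi_le hb ht)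
  rw [laplace_eq, withDensity_apply _ measurableSet_Iio, withDensity_apply _ measurableSet_Ioi,
    ← lintegral_indicator measurableSet_Iio, ← lintegral_indicator measurableSet_Ioi,
    ← lintegral_neg_eq_self]
  congr 1
  funext x
  simp [Set.indicator_apply, laplacePDF, neg_lt_neg_iff]

theorem laplace_pos_of_isOpen {b : ℝ} (hb : 0 < b) {U : Set ℝ} (hU : IsOpen U)
    (hne : U.Nonempty) : 0 < laplace b U := by
  rw [pos_iff_ne_zero]
  intro h0
  have hac : (volume : Measure ℝ) ≪ laplace b :=
    withDensity_absolutelyContinuous' (measurable_laplacePDF b).aemeasurable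
      (Filter.Eventually.of_forall fun x => by
        rw [Ne, ENNReal.ofReal_eq_zero, not_le]; positivity)
  exact (hU.measure_pos volume hne).ne' (hac h0)

theorem lintegral_ite_const {Ω : Type*} [MeasurableSpace Ω] (μ : Measure Ω) {p : Ω → Prop}
    [DecidablePred p] (hp : MeasurableSet {x | p x}) (A B : ℝ≥0∞) :
    ∫⁻ x, (if p x then A else B) ∂μ = μ {x | p x} * A + μ {x | ¬ p x} * B := by
  rw [← lintegral_add_compl _ hp, setLIntegral_congr_fun hp (g := fun _ => A),
    setLIntegral_congr_fun hp.compl (g := fun _ => B)]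
  · simp [mul_comm, Set.compl_def]
  · intro x hx; simp [show ¬ p x from hx]
  · intro x hx; simp [show p x from hx]

/-! ### The noisy comparisons of the sparse vector technique -/

/-- The probability that a score `a` with noise of scale `b` reaches the threshold `τ`. -/
def aboveProb (b a τ : ℝ) : ℝ≥0∞ := laplace b {ν | τ ≤ a + ν}

/-- The probability that a score `a` with noise of scale `b` stays below the threshold `τ`. -/
def belowProb (b a τ : ℝ) : ℝ≥0∞ := laplace b {ν | ¬ τ ≤ a + ν}

theorem measurableSet_above (a τ : ℝ) : MeasurableSet {ν : ℝ | τ ≤ a + ν} :=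
  measurableSet_le (by fun_prop) (by fun_prop)

theorem above_add_below {b : ℝ} (hb : 0 < b) (a τ : ℝ) :
    aboveProb b a τ + belowProb b a τ = 1 := by
  have := isProbabilityMeasure_laplace hb
  exact prob_add_prob_compl (measurableSet_above a τ)

theorem measurable_aboveProb (b a : ℝ) : Measurable (aboveProb b a) :=
  Antitone.measurable fun _ _ h => measure_mono fun _ hν => h.trans hν

theorem measurable_belowProb (b a : ℝ) : Measurable (belowProb b a) :=
  Monotone.measurable fun _ _ h => measure_mono fun _ hν h' => hν (h.trans h')

theorem aboveProb_pos {b : ℝ} (hb : 0 < b) (a τ : ℝ) : 0 < aboveProb b a τ :=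
  (laplace_pos_of_isOpen hb (isOpen_Ioi (a := τ - a)) ⟨τ - a + 1, by simp⟩).trans_le
    (measure_mono fun ν (hν : τ - a < ν) => by
      change τ ≤ a + ν; linarith)

theorem belowProb_pos {b : ℝ} (hb : 0 < b) (a τ : ℝ) : 0 < belowProb b a τ :=
  (laplace_pos_of_isOpen hb (isOpen_Iio (a := τ - a)) ⟨τ - a - 1, by simp⟩).trans_le
    (measure_mono fun ν (hν : ν < τ - a) => by
      change ¬ τ ≤ a + ν; linarith)

theorem expect_scan_cons {s : ℕ} (b τ η : ℝ) (K : List (Fin n)) (W : Fin n → ℝ) (D : Fin s → X)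
    (i : Fin n) (R : List (Fin n)) {c : ℕ}
    (hc : Evals H (computeScore η K W D i) (scoreValue H η K W D i) c)
    (f : Option (Fin n) → ℕ → ℝ≥0∞) :
    (scan b τ η K W D (i :: R)).expect H f =
      aboveProb b (scoreValue H η K W D i) τ * f (some i) (c + 3) +
        belowProb b (scoreValue H η K W D i) τ *
          (scan b τ η K W D R).expect H fun a t => f a (c + 2 + t) := by
  rw [aboveProb, belowProb, ← lintegral_ite_const _ (measurableSet_above _ _)]
  simp only [scan, expect_bind, expect_drawLaplace, hc _, expect_op, decide_eq_true_eq]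
  refine lintegral_congr fun ν => ?_
  split_ifs with h
  · simp only [expect_op]; congr 1; omega
  · congr 1; funext a t; congr 1; omega

theorem mean_scan_nil {s : ℕ} (b τ η : ℝ) (K : List (Fin n)) (W : Fin n → ℝ) (D : Fin s → X)
    (φ : Option (Fin n) → ℝ≥0∞) : mean H (scan b τ η K W D []) φ = φ none := rfl

theorem mean_scan_cons {s : ℕ} (b τ η : ℝ) (K : List (Fin n)) (W : Fin n → ℝ) (D : Fin s → X)
    (i : Fin n) (R : List (Fin n)) (φ : Option (Fin n) → ℝ≥0∞) :
    mean H (scan b τ η K W D (i :: R)) φ =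
      aboveProb b (scoreValue H η K W D i) τ * φ (some i) +
        belowProb b (scoreValue H η K W D i) τ * mean H (scan b τ η K W D R) φ := by
  obtain ⟨c, -, -, hc⟩ := evals_computeScore (H := H) η K W D i
  exact expect_scan_cons b τ η K W D i R hc _

theorem measurable_mean_scan {s : ℕ} (b η : ℝ) (K : List (Fin n)) (W : Fin n → ℝ) (D : Fin s → X)
    (R : List (Fin n)) (φ : Option (Fin n) → ℝ≥0∞) :
    Measurable fun τ => mean H (scan b τ η K W D R) φ := by
  induction R with
  | nil => exact measurable_const
  | cons i R ih =>
    simp only [mean_scan_cons]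
    have := measurable_aboveProb b (scoreValue H η K W D i)
    have := measurable_belowProb b (scoreValue H η K W D i)
    fun_prop

theorem isProb_scan {s : ℕ} {b : ℝ} (hb : 0 < b) (τ η : ℝ) (K : List (Fin n)) (W : Fin n → ℝ)
    (D : Fin s → X) (R : List (Fin n)) : IsProb H (scan b τ η K W D R) := by
  induction R with
  | nil => exact (Evals.op none).isProb
  | cons i R ih =>
    refine ⟨fun φ ψ => ?_, fun M => ?_⟩
    · simp only [mean_scan_cons, ih.add]; ring
    · simp only [mean_scan_cons, ih.const]
      rw [← add_mul, above_add_below hb, one_mul]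

theorem mean_findPrompting {s : ℕ} (ε Δ σ' η : ℝ) (R K : List (Fin n)) (W : Fin n → ℝ)
    (D : Fin s → X) (φ : Option (Fin n) → ℝ≥0∞) :
    mean H (findPrompting ε Δ σ' η R K W D) φ =
      ∫⁻ ρ, mean H (scan (2 * Δ / (ε / 2)) (3 * σ' / 4 + ρ) η K W D R) φ
        ∂(laplace (Δ / (ε / 2))) := by
  simp only [findPrompting, mean_bind, mean_op, mean_drawLaplace, sub_half]

theorem isProb_findPrompting {s : ℕ} {ε Δ : ℝ} (hε : 0 < ε) (hΔ : 0 < Δ) (σ' η : ℝ)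
    (R K : List (Fin n)) (W : Fin n → ℝ) (D : Fin s → X) :
    IsProb H (findPrompting ε Δ σ' η R K W D) := by
  have hs := fun τ => isProb_scan (H := H) (b := 2 * Δ / (ε / 2)) (by positivity) τ η K W D R
  have := isProbabilityMeasure_laplace (b := Δ / (ε / 2)) (by positivity)
  refine ⟨fun φ ψ => ?_, fun M => ?_⟩
  · simp only [mean_findPrompting, (hs _).add]
    exact lintegral_add_left ((measurable_mean_scan _ η K W D R φ).comp (by fun_prop)) _
  · simp [mean_findPrompting, (hs _).const]

theorem isProb_drawList {w : Fin n → ℝ} (h0 : ∀ j, 0 ≤ w j) (h : 0 < ∑ j, w j) (k : ℕ) :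
    IsProb H (drawList w k : Prog X n (List (Fin n))) := by
  induction k with
  | zero => exact (Evals.pure _).isProb
  | succ k ih =>
    exact (IsProb.drawIndex h0 h).bind fun j => ih.bind fun js => (Evals.op (j :: js)).isProb

theorem sum_exp_pos (hn : 0 < n) (g : Fin n → ℝ) : 0 < ∑ j, Real.exp (g j) :=
  Finset.sum_pos (fun _ _ => Real.exp_pos _) ⟨⟨0, hn⟩, Finset.mem_univ _⟩

/-- The weights from which a list of hypotheses is drawn. -/
def gibbs (ε Δ : ℝ) (W : Fin n → ℝ) : Fin n → ℝ :=
  fun j => Real.exp (-(ε * W j / (2 * Δ)))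

theorem mean_rounds_succ {s : ℕ} (εE εS σ β : ℝ) (k : ℕ) (D : Fin s → X) (t : ℕ)
    (A : Finset (Fin n)) (W : Fin n → ℝ) (φ : (Fin n → ℝ) → ℝ≥0∞) :
    mean H (rounds εE εS σ β k D (t + 1) A W) φ =
      mean H (drawList (gibbs εE (1 / s) W) k : Prog X n (List (Fin n))) fun K =>
        mean H (findPrompting εS (2 / s) (σ / 4) (β / 4)
          ((List.finRange n).filter (· ∉ A)) K W D) fun r =>
            r.elim (φ W) fun i => mean H (rounds εE εS σ β k D t (insert i A)
              fun j => max (W j) (semiDist H D i j)) φ := by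
  rw [rounds, (evals_expWeights _ _ _).mean_bind, mean_bind]
  congr 1
  funext K
  rw [(evals_remaining _ _).mean_bind, mean_bind]
  congr 1
  funext r
  cases r with
  | none => rfl
  | some i =>
    rw [Option.elim_some, (Evals.op _).mean_bind, (evals_update _ _ _).mean_bind]

theorem isProb_rounds {s : ℕ} {εE εS : ℝ} (hn : 0 < n) (hs : 0 < s) (hε : 0 < εS) (σ β : ℝ)
    (k : ℕ) (D : Fin s → X) (t : ℕ) (A : Finset (Fin n)) (W : Fin n → ℝ) :
    IsProb H (rounds εE εS σ β k D t A W) := by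
  induction t generalizing A W with
  | zero => exact (Evals.pure _).isProb
  | succ t ih =>
    have hs' : (0 : ℝ) < s := Nat.cast_pos.2 hs
    have hK := isProb_drawList (H := H) (w := gibbs εE (1 / s) W)
      (fun _ => (Real.exp_pos _).le) (sum_exp_pos hn _) k
    have hF := fun K => isProb_findPrompting (H := H) hε (by positivity : (0 : ℝ) < 2 / s)
      (σ / 4) (β / 4) ((List.finRange n).filter (· ∉ A)) K W D
    refine ⟨fun φ ψ => ?_, fun M => ?_⟩
    · simp only [mean_rounds_succ]
      rw [← hK.add]
      congr 1
      funext K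
      rw [← (hF K).add]
      congr 1
      funext r
      cases r with
      | none => rfl
      | some i => exact (ih _ _).add φ ψ
    · rw [mean_rounds_succ]
      refine Eq.trans ?_ (hK.const M)
      congr 1
      funext K
      refine Eq.trans ?_ ((hF K).const M)
      congr 1
      funext r
      cases r with
      | none => rfl
      | some i => exact (ih _ _).const M

theorem mean_selectHypothesis {s : ℕ} (T k : ℕ) (ε β σ : ℝ) (D : Fin s → X)
    (φ : Fin n → ℝ≥0∞) :
    mean H (selectHypothesis n s T k ε β σ D) φ =
      mean H (rounds (ε / (2 * (k * T + 1))) (ε / (2 * T)) σ β k D T ∅ fun _ => 0) fun W =>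
        mean H (drawIndex (gibbs (ε / (2 * (k * T + 1))) (1 / s) W) : Prog X n (Fin n)) φ := by
  rw [selectHypothesis, (Evals.op _).mean_bind, (Evals.op _).mean_bind,
    (evals_steps _).mean_bind, (evals_tabulate fun _ => Evals.op (0 : ℝ)).mean_bind, mean_bind]
  congr 1
  funext W
  rw [(evals_expWeights _ _ _).mean_bind]
  rfl

theorem isProb_selectHypothesis {s : ℕ} {T : ℕ} {ε : ℝ} (hn : 0 < n) (hs : 0 < s) (hT : 0 < T)
    (hε : 0 < ε) (k : ℕ) (β σ : ℝ) (D : Fin s → X) :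
    IsProb H (selectHypothesis n s T k ε β σ D) := by
  have hT' : (0 : ℝ) < T := Nat.cast_pos.2 hT
  have hR := isProb_rounds (H := H) (εE := ε / (2 * (k * T + 1))) hn hs
    (by positivity : 0 < ε / (2 * T)) σ β k D T ∅ fun _ => 0
  have hI := fun W => IsProb.drawIndex (H := H) (w := gibbs (ε / (2 * (k * T + 1))) (1 / s) W)
    (fun _ => (Real.exp_pos _).le) (sum_exp_pos hn _)
  refine ⟨fun φ ψ => ?_, fun M => ?_⟩
  · simp only [mean_selectHypothesis, (hI _).add, hR.add]
  · simp only [mean_selectHypothesis, (hI _).const, hR.const]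

/-! ### Differential privacy -/

/-- The multiplicative loss `e^x` of a privacy guarantee. -/
def loss (x : ℝ) : ℝ≥0∞ := ENNReal.ofReal (Real.exp x)

theorem loss_add (x y : ℝ) : loss (x + y) = loss x * loss y := by
  rw [loss, loss, loss, Real.exp_add, ENNReal.ofReal_mul (Real.exp_pos _).le]

theorem one_le_loss {x : ℝ} (hx : 0 ≤ x) : 1 ≤ loss x := by
  rw [loss, ← ENNReal.ofReal_one]
  exact ENNReal.ofReal_le_ofReal (Real.one_le_exp hx)

/-- Two data sets differ in at most one entry. -/
def Neighbors {s : ℕ} (D D' : Fin s → X) : Prop := ∃ l₀, ∀ l, l ≠ l₀ → D l = D' l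

theorem abs_semiDist_sub_le {s : ℕ} {D D' : Fin s → X} (h : Neighbors D D') (i j : Fin n) :
    |semiDist H D i j - semiDist H D' i j| ≤ 1 / s := by
  obtain ⟨l₀, hl⟩ := h
  refine (abs_abs_sub_abs_le _ _).trans ?_
  have hsum : ∑ l, (H.scheffe i j).indicator (1 : X → ℝ) (D' l) -
      ∑ l, (H.scheffe i j).indicator (1 : X → ℝ) (D l) =
      (H.scheffe i j).indicator 1 (D' l₀) - (H.scheffe i j).indicator 1 (D l₀) := by
    rw [← Finset.sum_sub_distrib]
    refine Finset.sum_eq_single l₀ (fun l _ h => by rw [hl l h, sub_self]) (by simp)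
  rw [sub_sub_sub_cancel_left, ← sub_div, hsum, abs_div, Nat.abs_cast]
  refine div_le_div_of_nonneg_right ?_ (Nat.cast_nonneg s)
  have h01 : ∀ x, 0 ≤ (H.scheffe i j).indicator (1 : X → ℝ) x ∧
      (H.scheffe i j).indicator (1 : X → ℝ) x ≤ 1 := fun x =>
    ⟨Set.indicator_nonneg (fun _ _ => zero_le_one) x,
      Set.indicator_le' (fun _ _ => le_rfl) (fun _ _ => zero_le_one) x⟩
  rw [abs_le]
  constructor <;> linarith [h01 (D l₀), h01 (D' l₀)]

theorem scoreValue_le_add {s : ℕ} {D D' : Fin s → X} (h : Neighbors D D') {W W' : Fin n → ℝ}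
    (hW : ∀ j, |W j - W' j| ≤ 1 / s) (η : ℝ) (K : List (Fin n)) (i : Fin n) :
    scoreValue H η K W D i ≤ scoreValue H η K W' D' i + 2 / s := by
  unfold scoreValue
  set m := ⌈η / 2 * K.length⌉₊ - 1
  by_cases hm : m < K.length
  · rw [← sub_le_iff_le_add, le_getD_insertionSort_iff _ (by rwa [List.length_map])]
    refine ((le_getD_insertionSort_iff (K.map fun j => semiDist H D i j - W j)
      (by rwa [List.length_map]) _).1 le_rfl).trans ?_
    rw [List.countP_map, List.countP_map]
    refine List.countP_mono_left fun j _ hj => ?_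
    simp only [Function.comp, decide_eq_true_eq] at hj ⊢
    have h1 := abs_le.1 (abs_semiDist_sub_le (H := H) h i j)
    have h2 := abs_le.1 (hW j)
    have h3 : (2 : ℝ) / s = 1 / s + 1 / s := by ring
    linarith
  · rw [List.getD_eq_default _ _ (by simpa using hm), List.getD_eq_default _ _ (by simpa using hm)]
    positivity

theorem aboveProb_le {b Δ a a' : ℝ} (hb : 0 < b) (hΔ : 0 ≤ Δ) (h : a ≤ a' + Δ) (τ : ℝ) :
    aboveProb b a τ ≤ loss (2 * Δ / b) * aboveProb b a' (τ + Δ) := by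
  have h1 := lintegral_laplace_add_le hb (by positivity : 0 ≤ 2 * Δ)
    ({ν | τ + Δ ≤ a' + ν}.indicator 1)
  rw [lintegral_indicator_one (measurableSet_above a' (τ + Δ))] at h1
  refine le_trans ?_ h1
  rw [aboveProb, ← lintegral_indicator_one (measurableSet_above a τ)]
  refine lintegral_mono fun ν => ?_
  by_cases hν : τ ≤ a + ν
  · have hν' : τ + Δ ≤ a' + (ν + 2 * Δ) := by linarith
    simp [hν, hν']
  · simp [hν]

theorem belowProb_le {b Δ a a' : ℝ} (h : a' ≤ a + Δ) (τ : ℝ) :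
    belowProb b a τ ≤ belowProb b a' (τ + Δ) :=
  measure_mono fun ν (hν : ¬ τ ≤ a + ν) => by
    change ¬ τ + Δ ≤ a' + ν
    linarith

/-- The coupling behind the sparse vector technique: raising the threshold by the sensitivity of
the scores compensates the change of every score below the threshold, and the noise of the one
score that reaches the threshold is translated by twice the sensitivity. -/
theorem mean_scan_le {s : ℕ} {b : ℝ} (hb : 0 < b) {D D' : Fin s → X} (h : Neighbors D D')
    {W W' : Fin n → ℝ} (hW : ∀ j, |W j - W' j| ≤ 1 / s) (η τ : ℝ) (K R : List (Fin n))
    {φ φ' : Option (Fin n) → ℝ≥0∞} {C : ℝ≥0∞} (hφ : ∀ r, φ r ≤ C * φ' r) :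
    mean H (scan b τ η K W D R) φ ≤
      loss (2 * (2 / s) / b) * C * mean H (scan b (τ + 2 / s) η K W' D' R) φ' := by
  have h' : Neighbors D' D := h.imp fun l₀ hl l hne => (hl l hne).symm
  have hW' : ∀ j, |W' j - W j| ≤ 1 / s := fun j => by rw [abs_sub_comm]; exact hW j
  induction R with
  | nil =>
    rw [mean_scan_nil, mean_scan_nil, mul_assoc]
    exact (hφ none).trans (le_mul_of_one_le_left' (one_le_loss (by positivity)))
  | cons i R ih =>
    rw [mean_scan_cons, mean_scan_cons, mul_add]
    refine add_le_add ?_ ?_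
    · calc _ ≤ (loss (2 * (2 / s) / b) * aboveProb b (scoreValue H η K W' D' i) (τ + 2 / s)) *
            (C * φ' (some i)) :=
          mul_le_mul' (aboveProb_le hb (by positivity) (scoreValue_le_add h hW η K i) τ) (hφ _)
        _ = _ := by ring
    · calc _ ≤ belowProb b (scoreValue H η K W' D' i) (τ + 2 / s) *
            (loss (2 * (2 / s) / b) * C * mean H (scan b (τ + 2 / s) η K W' D' R) φ') :=
          mul_le_mul' (belowProb_le (scoreValue_le_add h' hW' η K i) τ) ih
        _ = _ := by ring

theorem mean_findPrompting_le {s : ℕ} (hs : 0 < s) {ε : ℝ} (hε : 0 < ε) {D D' : Fin s → X}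
    (h : Neighbors D D') {W W' : Fin n → ℝ} (hW : ∀ j, |W j - W' j| ≤ 1 / s) (σ' η : ℝ)
    (R K : List (Fin n)) {φ φ' : Option (Fin n) → ℝ≥0∞} {C : ℝ≥0∞} (hφ : ∀ r, φ r ≤ C * φ' r) :
    mean H (findPrompting ε (2 / s) σ' η R K W D) φ ≤
      loss ε * C * mean H (findPrompting ε (2 / s) σ' η R K W' D') φ' := by
  have hs' : (0 : ℝ) < s := Nat.cast_pos.2 hs
  rw [mean_findPrompting, mean_findPrompting]
  set b := 2 * (2 / (s : ℝ)) / (ε / 2)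
  have hb : 0 < b := by positivity
  have hb' : 2 * (2 / (s : ℝ)) / b = ε / 2 := by simp only [b]; field_simp
  have hb'' : 2 / (s : ℝ) / (2 / s / (ε / 2)) = ε / 2 := by field_simp
  have hm := (measurable_mean_scan (H := H) b η K W' D' R φ').comp
    (by fun_prop : Measurable fun ρ : ℝ => 3 * σ' / 4 + ρ)
  calc _ ≤ ∫⁻ ρ, loss (ε / 2) * C *
          mean H (scan b (3 * σ' / 4 + (ρ + 2 / s)) η K W' D' R) φ'
            ∂(laplace (2 / s / (ε / 2))) := by
        refine lintegral_mono fun ρ => ?_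
        have := mean_scan_le (H := H) hb h hW η (3 * σ' / 4 + ρ) K R hφ
        rwa [hb', add_assoc] at this
    _ = loss (ε / 2) * C * ∫⁻ ρ, mean H (scan b (3 * σ' / 4 + (ρ + 2 / s)) η K W' D' R) φ'
            ∂(laplace (2 / s / (ε / 2))) :=
        lintegral_const_mul _ (hm.comp (by fun_prop : Measurable fun ρ : ℝ => ρ + 2 / s))
    _ ≤ loss (ε / 2) * C * (loss (ε / 2) *
          ∫⁻ ρ, mean H (scan b (3 * σ' / 4 + ρ) η K W' D' R) φ' ∂(laplace (2 / s / (ε / 2)))) := by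
        refine mul_le_mul_right ?_ _
        have := lintegral_laplace_add_le (b := 2 / s / (ε / 2)) (δ := 2 / s) (by positivity)
          (by positivity) fun ρ => mean H (scan b (3 * σ' / 4 + ρ) η K W' D' R) φ'
        rwa [hb''] at this
    _ = _ := by
        rw [← add_halves ε, loss_add, add_halves ε]
        ring

theorem gibbs_div_sum_le {s : ℕ} (hs : 0 < s) {ε : ℝ} (hε : 0 < ε) {W W' : Fin n → ℝ}
    (hW : ∀ j, |W j - W' j| ≤ 1 / s) (j : Fin n) :
    ENNReal.ofReal (gibbs ε (1 / s) W j / ∑ i, gibbs ε (1 / s) W i) ≤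
      loss ε * ENNReal.ofReal (gibbs ε (1 / s) W' j / ∑ i, gibbs ε (1 / s) W' i) := by
  have hs' : (0 : ℝ) < s := Nat.cast_pos.2 hs
  have hn : 0 < n := j.pos
  have key : ∀ V V' : Fin n → ℝ, (∀ j, |V j - V' j| ≤ 1 / s) → ∀ j,
      gibbs ε (1 / s) V j ≤ Real.exp (ε / 2) * gibbs ε (1 / s) V' j := fun V V' hV j => by
    unfold gibbs
    rw [← Real.exp_add]
    refine Real.exp_le_exp.2 ?_
    have h1 := (abs_le.1 (hV j)).1
    have h2 : ε * V' j / (2 * (1 / s)) - ε * V j / (2 * (1 / s)) = ε / 2 * (s * (V' j - V j)) := by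
      field_simp
    have h3 : s * (V' j - V j) ≤ 1 := by
      rw [mul_comm, ← le_div_iff₀ hs']; linarith
    nlinarith
  have hS : 0 < ∑ i, gibbs ε (1 / s) W i := sum_exp_pos hn _
  have hS' : 0 < ∑ i, gibbs ε (1 / s) W' i := sum_exp_pos hn _
  rw [loss, ← ENNReal.ofReal_mul (Real.exp_pos _).le]
  refine ENNReal.ofReal_le_ofReal ?_
  have h1 := key W W' hW j
  have h2 : ∑ i, gibbs ε (1 / s) W' i ≤ Real.exp (ε / 2) * ∑ i, gibbs ε (1 / s) W i := by
    rw [Finset.mul_sum]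
    exact Finset.sum_le_sum fun i _ => key W' W (fun j => by rw [abs_sub_comm]; exact hW j) i
  rw [← mul_div_assoc, div_le_div_iff₀ hS hS', ← add_halves ε, Real.exp_add, add_halves ε]
  have h0 : 0 ≤ gibbs ε (1 / s) W' j := (Real.exp_pos _).le
  calc _ ≤ (Real.exp (ε / 2) * gibbs ε (1 / s) W' j) *
        (Real.exp (ε / 2) * ∑ i, gibbs ε (1 / s) W i) := mul_le_mul h1 h2 hS'.le (by positivity)
    _ = _ := by ring

theorem mean_drawIndex_le {s : ℕ} (hs : 0 < s) {ε : ℝ} (hε : 0 < ε) {W W' : Fin n → ℝ}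
    (hW : ∀ j, |W j - W' j| ≤ 1 / s) {φ φ' : Fin n → ℝ≥0∞} {C : ℝ≥0∞}
    (hφ : ∀ j, φ j ≤ C * φ' j) :
    mean H (drawIndex (gibbs ε (1 / s) W) : Prog X n (Fin n)) φ ≤
      loss ε * C * mean H (drawIndex (gibbs ε (1 / s) W') : Prog X n (Fin n)) φ' := by
  rw [mean_drawIndex, mean_drawIndex, Finset.mul_sum]
  refine Finset.sum_le_sum fun j _ => ?_
  refine (mul_le_mul' (gibbs_div_sum_le hs hε hW j) (hφ j)).trans_eq ?_
  ring

theorem mean_drawList_le {s : ℕ} (hs : 0 < s) {ε : ℝ} (hε : 0 < ε) {W W' : Fin n → ℝ}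
    (hW : ∀ j, |W j - W' j| ≤ 1 / s) (k : ℕ) {φ φ' : List (Fin n) → ℝ≥0∞} {C : ℝ≥0∞}
    (hφ : ∀ K, φ K ≤ C * φ' K) :
    mean H (drawList (gibbs ε (1 / s) W) k : Prog X n (List (Fin n))) φ ≤
      loss (k * ε) * C *
        mean H (drawList (gibbs ε (1 / s) W') k : Prog X n (List (Fin n))) φ' := by
  induction k generalizing φ φ' with
  | zero => simpa [drawList, loss] using hφ []
  | succ k ih =>
    simp only [drawList, mean_bind, mean_op]
    have h1 : loss ((k + 1 : ℕ) * ε) * C = loss ε * (loss (k * ε) * C) := by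
      rw [← mul_assoc, ← loss_add]; congr 2; push_cast; ring
    rw [h1]
    exact mean_drawIndex_le hs hε hW fun j => ih fun js => hφ (j :: js)

theorem mean_rounds_le {s : ℕ} (hs : 0 < s) {εE εS : ℝ} (hE : 0 < εE) (hS : 0 < εS) (σ β : ℝ)
    (k : ℕ) {D D' : Fin s → X} (h : Neighbors D D') (t : ℕ) (A : Finset (Fin n))
    {W W' : Fin n → ℝ} (hW : ∀ j, |W j - W' j| ≤ 1 / s) {φ φ' : (Fin n → ℝ) → ℝ≥0∞} {C : ℝ≥0∞}
    (hφ : ∀ V V', (∀ j, |V j - V' j| ≤ 1 / (s : ℝ)) → φ V ≤ C * φ' V') :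
    mean H (rounds εE εS σ β k D t A W) φ ≤
      loss (t * (k * εE + εS)) * C * mean H (rounds εE εS σ β k D' t A W') φ' := by
  induction t generalizing A W W' with
  | zero => simpa [rounds, loss] using hφ W W' hW
  | succ t ih =>
    have h1 : loss ((t + 1 : ℕ) * (k * εE + εS)) * C =
        loss (k * εE) * (loss εS * (loss (t * (k * εE + εS)) * C)) := by
      rw [← mul_assoc, ← mul_assoc, ← loss_add, ← loss_add]; congr 2; push_cast; ring
    have h0 : 0 ≤ t * (k * εE + εS) := by positivity
    rw [mean_rounds_succ, mean_rounds_succ, h1]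
    refine mean_drawList_le hs hE hW k fun K => mean_findPrompting_le hs hS h hW _ _ _ K ?_
    rintro (_ | i)
    · simp only [Option.elim_none]
      rw [mul_assoc]
      exact (hφ W W' hW).trans (le_mul_of_one_le_left' (one_le_loss h0))
    · exact ih (insert i A) fun j => (abs_max_sub_max_le_max _ _ _ _).trans
        (max_le (hW j) (abs_semiDist_sub_le h i j))

/-- The privacy budget is split evenly: one half for the `T` runs of the sparse vector technique,
the other half for the `k * T + 1` draws by the exponential mechanism. -/
theorem mean_selectHypothesis_le {s T : ℕ} (hs : 0 < s) (hT : 0 < T) (k : ℕ) {ε : ℝ}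
    (hε : 0 < ε) (β σ : ℝ) {D D' : Fin s → X} (h : Neighbors D D') (φ : Fin n → ℝ≥0∞) :
    mean H (selectHypothesis n s T k ε β σ D) φ ≤
      loss ε * mean H (selectHypothesis n s T k ε β σ D') φ := by
  have hT' : (0 : ℝ) < T := Nat.cast_pos.2 hT
  have hE : 0 < ε / (2 * (k * T + 1)) := by positivity
  have hS : 0 < ε / (2 * T) := by positivity
  have heps : ε = T * (k * (ε / (2 * (k * T + 1))) + ε / (2 * T)) + ε / (2 * (k * T + 1)) := by
    field_simp; ring
  rw [mean_selectHypothesis, mean_selectHypothesis]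
  have hl : loss ε = loss (T * (k * (ε / (2 * (k * T + 1))) + ε / (2 * T))) *
      loss (ε / (2 * (k * T + 1))) := by rw [← loss_add, ← heps]
  rw [hl]
  refine mean_rounds_le hs hE hS σ β k h T ∅ (fun j => by simp) fun V V' hV => ?_
  have := mean_drawIndex_le (H := H) hs hE hV (φ := φ) (φ' := φ) (C := 1) (by simp)
  rwa [mul_one] at this

/-! ### Running time -/

theorem ensures_scan {s : ℕ} (b τ η : ℝ) (K : List (Fin n)) (W : Fin n → ℝ) (D : Fin s → X)
    (R : List (Fin n)) :
    Ensures H (scan b τ η K W D R) (fun _ => True)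
      (R.length * (K.length * (2 * s + 2 * K.length + 7) + 4) + 1) := by
  induction R with
  | nil => exact Ensures.mono (Ensures.op trivial) (fun _ h => h) (by simp)
  | cons i R ih =>
    obtain ⟨c, -, hc, hE⟩ := evals_computeScore (H := H) η K W D i
    intro f hf
    rw [expect_scan_cons b τ η K W D i R hE, hf _ _ trivial, mul_zero, zero_add,
      ih _ fun a t _ ht => hf _ _ trivial ?_, mul_zero]
    · rw [List.length_cons, add_mul, one_mul]; omega
    · rw [List.length_cons, add_mul, one_mul]; omega

theorem ensures_drawList (w : Fin n → ℝ) (k : ℕ) :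
    Ensures H (drawList w k : Prog X n (List (Fin n))) (fun K => K.length = k) (k * (n + 1)) := by
  induction k with
  | zero => exact (Evals.pure _).ensures rfl (by simp)
  | succ k ih =>
    refine Ensures.mono ((Ensures.drawIndex w).bind fun j _ =>
      ih.bind fun js hjs => Ensures.op (P := fun K : List (Fin n) => K.length = k + 1) (by simp [hjs]))
      (fun _ h => h) (le_of_eq ?_)
    ring

theorem ensures_rounds {s : ℕ} (εE εS σ β : ℝ) (k : ℕ) (D : Fin s → X) (t : ℕ)
    (A : Finset (Fin n)) (W : Fin n → ℝ) :
    Ensures H (rounds εE εS σ β k D t A W) (fun _ => True)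
      (t * (n * (k * (2 * s + 2 * k + 7) + 4) + k * (n + 1) + n * (2 * s + 6) + 7)) := by
  induction t generalizing A W with
  | zero => exact (Evals.pure _).ensures trivial (by simp)
  | succ t ih =>
    have hR : ((List.finRange n).filter (· ∉ A)).length ≤ n :=
      (List.length_filter_le _ _).trans (by simp)
    have hF : ∀ K : List (Fin n), K.length = k →
        Ensures H (findPrompting εS (2 / s) (σ / 4) (β / 4) ((List.finRange n).filter (· ∉ A)) K W D)
          (fun _ => True) (n * (k * (2 * s + 2 * k + 7) + 4) + 6) := fun K hK => by
      refine Ensures.mono ((Ensures.op_true _).bind fun _ _ => (Ensures.op_true _).bind fun _ _ =>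
        (Ensures.drawLaplace _).bind fun _ _ => (Ensures.op_true _).bind fun _ _ =>
        (Ensures.op_true _).bind fun _ _ => ensures_scan _ _ _ K W D _) (fun _ h => h) ?_
      rw [hK]
      have := Nat.mul_le_mul_right (k * (2 * s + 2 * k + 7) + 4) hR
      omega
    refine Ensures.mono (B := n + (k * (n + 1) + (n + ((n * (k * (2 * s + 2 * k + 7) + 4) + 6) +
      (1 + (n * (2 * s + 4) + t * (n * (k * (2 * s + 2 * k + 7) + 4) + k * (n + 1) +
        n * (2 * s + 6) + 7))))))) ?_ (fun _ h => h) (le_of_eq (by ring))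
    refine Ensures.bind ((evals_expWeights _ _ _).ensures (P := fun _ => True) trivial le_rfl)
      fun Q _ => ?_
    refine (ensures_drawList Q k).bind fun K hK => ?_
    refine Ensures.bind ((evals_remaining _ _).ensures
      (P := fun R => R = (List.finRange n).filter (· ∉ A)) rfl (by simp)) ?_
    rintro R rfl
    refine (hF K hK).bind ?_
    rintro (_ | i) -
    · exact (Evals.pure W).ensures trivial (Nat.zero_le _)
    · refine Ensures.bind (Ensures.op (P := fun _ => True) trivial) fun A' _ => ?_
      exact Ensures.bind ((evals_update D W i).ensures (P := fun _ => True) trivial le_rfl)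
        fun W' _ => ih A' W'

theorem ensures_selectHypothesis {s T k : ℕ} (hn : 0 < n) (hs : 0 < s) (hT : 0 < T) (hk : 0 < k)
    (ε β σ : ℝ) (D : Fin s → X) :
    Ensures H (selectHypothesis n s T k ε β σ D) (fun _ => True)
      (n * k * T * (36 * s + 2 * k)) := by
  refine Ensures.mono (B := 1 + (1 + (s + (n * 1 +
    (T * (n * (k * (2 * s + 2 * k + 7) + 4) + k * (n + 1) + n * (2 * s + 6) + 7) + (n + n))))))
    ?_ (fun _ h => h) ?_
  · refine (Ensures.op_true _).bind fun _ _ => (Ensures.op_true _).bind fun _ _ => ?_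
    refine Ensures.bind ((evals_steps s).ensures (P := fun _ => True) trivial le_rfl) fun _ _ => ?_
    refine Ensures.bind ((evals_tabulate fun _ => Evals.op (0 : ℝ)).ensures
      (P := fun _ => True) trivial le_rfl) fun W₀ _ => ?_
    refine Ensures.bind (ensures_rounds _ _ σ β k D T ∅ W₀) fun W _ => ?_
    exact Ensures.bind ((evals_expWeights _ _ _).ensures (P := fun _ => True) trivial le_rfl)
      fun Q _ => Ensures.drawIndex Q
  · obtain ⟨n, rfl⟩ := Nat.exists_eq_add_of_lt hn
    obtain ⟨s, rfl⟩ := Nat.exists_eq_add_of_lt hs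
    obtain ⟨T, rfl⟩ := Nat.exists_eq_add_of_lt hT
    obtain ⟨k, rfl⟩ := Nat.exists_eq_add_of_lt hk
    ring_nf
    gcongr <;> omega

/-- The last hypothesis of a nonempty list can be the one that is found, and then the scores of
all hypotheses in the list are computed. The probability of this run is a measurable function of
the threshold. -/
theorem exists_measurable_scan {s : ℕ} {b : ℝ} (hb : 0 < b) (η : ℝ) (K : List (Fin n))
    (W : Fin n → ℝ) (D : Fin s → X) {R : List (Fin n)} (hR : R ≠ []) :
    ∃ i ∈ R, ∃ c, R.length * (K.length * s) ≤ c ∧ ∃ q : ℝ → ℝ≥0∞, Measurable q ∧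
      (∀ τ, 0 < q τ) ∧ ∀ τ f, q τ * f (some i) c ≤ (scan b τ η K W D R).expect H f := by
  induction R with
  | nil => exact absurd rfl hR
  | cons j R ih =>
    obtain ⟨d, hd, -, hE⟩ := evals_computeScore (H := H) η K W D j
    by_cases hR' : R = []
    · subst hR'
      refine ⟨j, by simp, d + 3, by simp; omega, aboveProb b (scoreValue H η K W D j),
        measurable_aboveProb _ _, aboveProb_pos hb _, fun τ f => ?_⟩
      rw [expect_scan_cons b τ η K W D j [] hE]
      exact le_self_add
    · obtain ⟨i, hi, c, hc, q, hqm, hq, hqe⟩ := ih hR'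
      refine ⟨i, by simp [hi], d + 2 + c, by rw [List.length_cons, add_mul, one_mul]; omega,
        fun τ => belowProb b (scoreValue H η K W D j) τ * q τ,
        (measurable_belowProb _ _).mul hqm,
        fun τ => ENNReal.mul_pos (belowProb_pos hb _ τ).ne' (hq τ).ne', fun τ f => ?_⟩
      rw [expect_scan_cons b τ η K W D j R hE, mul_assoc]
      exact (mul_le_mul_right (hqe τ fun a t => f a (d + 2 + t)) _).trans le_add_self

theorem canTake_findPrompting {s : ℕ} (hs : 0 < s) {ε : ℝ} (hε : 0 < ε) (σ' η : ℝ)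
    (K : List (Fin n)) (W : Fin n → ℝ) (D : Fin s → X) {R : List (Fin n)} (hR : R ≠ []) :
    ∃ i ∈ R, ∃ c, R.length * (K.length * s) ≤ c ∧
      CanTake H (findPrompting ε (2 / s) σ' η R K W D) (some i) c := by
  have hs' : (0 : ℝ) < s := Nat.cast_pos.2 hs
  obtain ⟨i, hi, c, hc, q, hqm, hq, hqe⟩ := exists_measurable_scan (H := H)
    (b := 2 * (2 / s) / (ε / 2)) (by positivity) η K W D hR
  have := isProbabilityMeasure_laplace (b := 2 / (s : ℝ) / (ε / 2)) (by positivity)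
  have hqm' : Measurable fun ρ => q (3 * σ' / 4 + ρ) := hqm.comp (by fun_prop)
  refine ⟨i, hi, c + 5, by omega,
    ∫⁻ ρ, q (3 * σ' / 4 + ρ) ∂(laplace (2 / s / (ε / 2))), ?_, fun f => ?_⟩
  · rw [lintegral_pos_iff_support hqm']
    have : Function.support (fun ρ => q (3 * σ' / 4 + ρ)) = Set.univ :=
      Set.eq_univ_of_forall fun ρ => (hq _).ne'
    rw [this, measure_univ]
    exact one_pos
  · rw [← lintegral_mul_const _ hqm']
    simp only [findPrompting, expect_bind, expect_op, expect_drawLaplace, sub_half]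
    refine lintegral_mono fun ρ => ?_
    have := hqe (3 * σ' / 4 + ρ) fun a t => f a (1 + (1 + (1 + (1 + (1 + t)))))
    convert this using 3
    omega

theorem canTake_drawList {w : Fin n → ℝ} (hw : ∀ j, 0 < w j) (hn : 0 < n) (k : ℕ) :
    ∃ K c, K.length = k ∧ CanTake H (drawList w k : Prog X n (List (Fin n))) K c := by
  induction k with
  | zero => exact ⟨[], 0, rfl, (Evals.pure _).canTake⟩
  | succ k ih =>
    obtain ⟨K, c, hK, hc⟩ := ih
    exact ⟨⟨0, hn⟩ :: K, _, by simp [hK],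
      (CanTake.drawIndex hw ⟨0, hn⟩).bind (hc.bind (Evals.op _).canTake)⟩

theorem length_filter_notMem (A : Finset (Fin n)) :
    ((List.finRange n).filter (· ∉ A)).length = n - A.card := by
  have h := List.toFinset_card_of_nodup ((List.nodup_finRange n).filter (· ∉ A))
  rw [← h]
  have : ((List.finRange n).filter (· ∉ A)).toFinset = Aᶜ := by ext i; simp
  rw [this, Finset.card_compl, Fintype.card_fin]

/-- It can happen that no round ends the loop and that each of them goes through the whole list of
remaining hypotheses. -/
theorem canTake_rounds {s : ℕ} (hs : 0 < s) {εS : ℝ} (hS : 0 < εS) (εE σ β : ℝ) (k : ℕ)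
    (D : Fin s → X) (t : ℕ) (A : Finset (Fin n)) (W : Fin n → ℝ) (hA : A.card + t ≤ n) :
    ∃ W' c, t * (n - A.card) * (k * s) ≤ 2 * c ∧
      CanTake H (rounds εE εS σ β k D t A W) W' c := by
  induction t generalizing A W with
  | zero => exact ⟨W, 0, by simp, (Evals.pure _).canTake⟩
  | succ t ih =>
    obtain ⟨K, c₁, hK, h₁⟩ := canTake_drawList (H := H) (w := gibbs εE (1 / s) W)
      (fun _ => Real.exp_pos _) (by omega) k
    have hlen := length_filter_notMem A
    have hne : (List.finRange n).filter (· ∉ A) ≠ [] := fun h => by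
      rw [h, List.length_nil] at hlen; omega
    obtain ⟨i, hi, c₂, hc₂, h₂⟩ :=
      canTake_findPrompting (H := H) hs hS (σ / 4) (β / 4) K W D hne
    have hiA : i ∉ A := by simpa using hi
    have hcard := Finset.card_insert_of_notMem hiA
    obtain ⟨W', c₃, hc₃, h₃⟩ := ih (insert i A) (fun j => max (W j) (semiDist H D i j)) (by omega)
    refine ⟨W', _, ?_, (evals_expWeights _ _ _).canTake.bind (h₁.bind
      ((evals_remaining _ _).canTake.bind (h₂.bind
        ((Evals.op _).canTake.bind ((evals_update _ _ _).canTake.bind h₃)))))⟩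
    rw [hlen, hK] at hc₂
    rw [hcard] at hc₃
    obtain ⟨m, hm⟩ : ∃ m, n - A.card = t + 1 + m := ⟨n - A.card - (t + 1), by omega⟩
    rw [hm] at hc₂ ⊢
    rw [show n - (A.card + 1) = t + m by omega] at hc₃
    have := Nat.zero_le ((1 + m) * (k * s))
    have h4 : (t + 1) * (t + 1 + m) * (k * s) + (1 + m) * (k * s) =
      2 * ((t + 1 + m) * (k * s)) + t * (t + m) * (k * s) := by ring
    omega

theorem canTake_selectHypothesis {s T : ℕ} (hn : 0 < n) (hs : 0 < s) (hT : 0 < T) (hTn : T ≤ n)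
    {ε : ℝ} (hε : 0 < ε) (k : ℕ) (β σ : ℝ) (D : Fin s → X) :
    ∃ i c, T * n * (k * s) ≤ 2 * c ∧ CanTake H (selectHypothesis n s T k ε β σ D) i c := by
  have hT' : (0 : ℝ) < T := Nat.cast_pos.2 hT
  obtain ⟨W', c, hc, h⟩ := canTake_rounds (H := H) hs (by positivity : 0 < ε / (2 * T))
    (ε / (2 * (k * T + 1))) σ β k D T ∅ (fun _ => 0) (by simpa using hTn)
  refine ⟨⟨0, hn⟩, _, ?_, (Evals.op _).canTake.bind ((Evals.op _).canTake.bind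
    ((evals_steps s).canTake.bind ((evals_tabulate fun _ => Evals.op (0 : ℝ)).canTake.bind
      (h.bind ((evals_expWeights _ _ _).canTake.bind
        (CanTake.drawIndex (fun _ => Real.exp_pos _) _))))))⟩
  rw [Finset.card_empty, Nat.sub_zero] at hc
  omega

/-! ### Total variation distance and Scheffé sets -/

theorem isProbabilityMeasure_law (H : HypothesisClass X n) (i : Fin n) :
    IsProbabilityMeasure (H.law i) :=
  ⟨by rw [HypothesisClass.law, withDensity_apply _ MeasurableSet.univ, Measure.restrict_univ,
    H.lintegral_pdf i]⟩

theorem measurableSet_scheffe (H : HypothesisClass X n) (i j : Fin n) :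
    MeasurableSet (H.scheffe i j) :=
  measurableSet_lt (H.measurable_pdf _) (H.measurable_pdf _)

theorem abs_real_sub_real_le_one (P Q : Measure X) [IsProbabilityMeasure P]
    [IsProbabilityMeasure Q] (S : Set X) : |P.real S - Q.real S| ≤ 1 := by
  have h1 : P.real S ≤ 1 := measureReal_le_one
  have h2 : Q.real S ≤ 1 := measureReal_le_one
  have h3 : 0 ≤ P.real S := measureReal_nonneg
  have h4 : 0 ≤ Q.real S := measureReal_nonneg
  rw [abs_le]
  constructor <;> linarith

theorem le_tvDist (P Q : Measure X) [IsProbabilityMeasure P] [IsProbabilityMeasure Q] {S : Set X}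
    (hS : MeasurableSet S) : |P.real S - Q.real S| ≤ tvDist P Q :=
  le_ciSup (f := fun S : {S : Set X // MeasurableSet S} => |P.real S.1 - Q.real S.1|)
    ⟨1, by rintro _ ⟨S, rfl⟩; exact abs_real_sub_real_le_one P Q S.1⟩ ⟨S, hS⟩

theorem tvDist_nonneg (P Q : Measure X) : 0 ≤ tvDist P Q :=
  Real.iSup_nonneg fun _ => abs_nonneg _

theorem tvDist_le {P Q : Measure X} {c : ℝ} (h : ∀ S, MeasurableSet S → |P.real S - Q.real S| ≤ c) :
    tvDist P Q ≤ c := by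
  have : Nonempty {S : Set X // MeasurableSet S} := ⟨⟨∅, MeasurableSet.empty⟩⟩
  exact ciSup_le fun S => h S.1 S.2

/-- The set on which the density of `H_b` exceeds that of `H_a` maximizes `H_b - H_a`. -/
theorem law_sub_law_le (H : HypothesisClass X n) (a b : Fin n) {E : Set X} (hE : MeasurableSet E) :
    (H.law b).real E - (H.law a).real E ≤
      (H.law b).real {x | H.pdf a x < H.pdf b x} - (H.law a).real {x | H.pdf a x < H.pdf b x} := by
  have := isProbabilityMeasure_law H a
  have := isProbabilityMeasure_law H b
  set S := {x | H.pdf a x < H.pdf b x}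
  have hS : MeasurableSet S := measurableSet_lt (H.measurable_pdf _) (H.measurable_pdf _)
  have hdiff : ∀ i, (H.law i).real E = (H.law i).real (E ∩ S) + (H.law i).real (E \ S) :=
    fun i => by
      have := isProbabilityMeasure_law H i
      exact (measureReal_inter_add_sdiff hS).symm
  have hdiff' : ∀ i, (H.law i).real S = (H.law i).real (E ∩ S) + (H.law i).real (S \ E) :=
    fun i => by
      have := isProbabilityMeasure_law H i
      rw [Set.inter_comm]
      exact (measureReal_inter_add_sdiff hE).symm
  have h1 : (H.law b).real (E \ S) ≤ (H.law a).real (E \ S) := by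
    refine ENNReal.toReal_mono (measure_ne_top _ _) ?_
    rw [HypothesisClass.law, HypothesisClass.law, withDensity_apply _ (hE.diff hS),
      withDensity_apply _ (hE.diff hS)]
    exact setLIntegral_mono (H.measurable_pdf _) fun x hx => not_lt.1 hx.2
  have h2 : (H.law a).real (S \ E) ≤ (H.law b).real (S \ E) := by
    refine ENNReal.toReal_mono (measure_ne_top _ _) ?_
    rw [HypothesisClass.law, HypothesisClass.law, withDensity_apply _ (hS.diff hE),
      withDensity_apply _ (hS.diff hE)]
    exact setLIntegral_mono (H.measurable_pdf _) fun x hx => le_of_lt hx.1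
  rw [hdiff a, hdiff b, hdiff' a, hdiff' b]
  linarith

theorem abs_law_sub_law_le (H : HypothesisClass X n) (a b : Fin n) {E : Set X}
    (hE : MeasurableSet E) :
    |(H.law a).real E - (H.law b).real E| ≤
      |(H.law a).real (H.scheffe a b) - (H.law b).real (H.scheffe a b)| := by
  have key : ∀ a b : Fin n, |(H.law a).real E - (H.law b).real E| ≤
      |(H.law a).real {x | H.pdf a x < H.pdf b x} -
        (H.law b).real {x | H.pdf a x < H.pdf b x}| := fun a b => by
    have := isProbabilityMeasure_law H a
    have := isProbabilityMeasure_law H b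
    have h1 := law_sub_law_le H a b hE
    have h2 := law_sub_law_le H a b hE.compl
    rw [probReal_compl_eq_one_sub hE, probReal_compl_eq_one_sub hE] at h2
    refine le_trans (abs_le.2 ⟨?_, ?_⟩) (neg_le_abs _) <;> linarith
  rcases le_total a b with h | h
  · simpa only [HypothesisClass.scheffe, min_eq_left h, max_eq_right h] using key a b
  · rw [abs_sub_comm, abs_sub_comm ((H.law a).real (H.scheffe a b))]
    simpa only [HypothesisClass.scheffe, min_eq_right h, max_eq_left h] using key b a

/-- A hypothesis that the Scheffé test against a hypothesis at distance `d` does not refute by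
more than `w` has distance at most `w + 2 d`. -/
theorem tvDist_law_le (H : HypothesisClass X n) (P : Measure X) [IsProbabilityMeasure P]
    (i j : Fin n) :
    tvDist (H.law j) P ≤ |(H.law j).real (H.scheffe i j) - P.real (H.scheffe i j)| +
      2 * tvDist (H.law i) P := by
  have := isProbabilityMeasure_law H i
  refine tvDist_le fun E hE => ?_
  have h1 := abs_law_sub_law_le H j i hE
  rw [scheffe_comm H j i] at h1
  have h2 := le_tvDist (H.law i) P hE
  have h3 := le_tvDist (H.law i) P (measurableSet_scheffe H i j)
  have h4 := abs_sub_le ((H.law j).real E) ((H.law i).real E) (P.real E)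
  have h5 := abs_sub_le ((H.law j).real (H.scheffe i j)) (P.real (H.scheffe i j))
    ((H.law i).real (H.scheffe i j))
  rw [abs_sub_comm (P.real (H.scheffe i j))] at h5
  linarith

/-! ### Concentration of the empirical frequencies -/

theorem measure_sum_ge_le {Y : X → ℝ} (P : Measure X) [IsProbabilityMeasure P]
    (hY : HasSubgaussianMGF Y (1 / 4) P) {s : ℕ} (hs : 0 < s) {t : ℝ} (ht : 0 ≤ t) :
    (Measure.pi fun _ : Fin s => P).real {D | s * t ≤ ∑ l, Y (D l)} ≤
      Real.exp (-2 * s * t ^ 2) := by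
  have hs' : (0 : ℝ) < s := Nat.cast_pos.2 hs
  have hi : iIndepFun (fun l (D : Fin s → X) => Y (D l)) (Measure.pi fun _ : Fin s => P) :=
    iIndepFun_pi (X := fun _ => Y) fun _ => hY.aemeasurable
  have hsub : ∀ l ∈ (Finset.univ : Finset (Fin s)), HasSubgaussianMGF
      (fun D : Fin s → X => Y (D l)) (1 / 4) (Measure.pi fun _ : Fin s => P) := fun l _ => by
    refine HasSubgaussianMGF.of_map (X := Y) (Y := fun D : Fin s → X => D l)
      (measurable_pi_apply l).aemeasurable ?_
    rwa [(measurePreserving_eval (fun _ : Fin s => P) l).map_eq]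
  refine (HasSubgaussianMGF.measure_sum_ge_le_of_iIndepFun hi hsub
    (by positivity : 0 ≤ s * t)).trans_eq ?_
  congr 1
  simp
  field_simp
  ring

/-- Hoeffding's inequality for the empirical frequency of an event. -/
theorem measure_abs_freq_sub_gt_le (P : Measure X) [IsProbabilityMeasure P] {S : Set X}
    (hS : MeasurableSet S) {s : ℕ} (hs : 0 < s) {t : ℝ} (ht : 0 ≤ t) :
    (Measure.pi fun _ : Fin s => P).real
        {D | t < |P.real S - (∑ l, S.indicator (1 : X → ℝ) (D l)) / s|} ≤
      2 * Real.exp (-2 * s * t ^ 2) := by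
  have hs' : (0 : ℝ) < s := Nat.cast_pos.2 hs
  have hY : HasSubgaussianMGF (fun x => S.indicator (1 : X → ℝ) x - P.real S) (1 / 4) P := by
    have h := hasSubgaussianMGF_of_mem_Icc (μ := P) (X := S.indicator (1 : X → ℝ)) (a := 0) (b := 1)
      (measurable_one.indicator hS).aemeasurable (Filter.Eventually.of_forall fun x =>
        ⟨Set.indicator_nonneg (fun _ _ => zero_le_one) x,
          Set.indicator_le' (fun _ _ => le_rfl) (fun _ _ => zero_le_one) x⟩)
    rw [integral_indicator_one hS] at h
    convert h using 1
    rw [sub_zero, nnnorm_one]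
    norm_num
  have hsum : ∀ D : Fin s → X, ∑ l, (S.indicator (1 : X → ℝ) (D l) - P.real S) =
      ∑ l, S.indicator (1 : X → ℝ) (D l) - s * P.real S := fun D => by
    simp [Finset.sum_sub_distrib]
  have hsub : {D : Fin s → X | t < |P.real S - (∑ l, S.indicator (1 : X → ℝ) (D l)) / s|} ⊆
      {D | s * t ≤ ∑ l, (fun x => S.indicator (1 : X → ℝ) x - P.real S) (D l)} ∪
        {D | s * t ≤ ∑ l, (-fun x => S.indicator (1 : X → ℝ) x - P.real S) (D l)} := by
    intro D hD
    have hD : t < |P.real S - (∑ l, S.indicator (1 : X → ℝ) (D l)) / s| := hD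
    have hmul : s * ((∑ l, S.indicator (1 : X → ℝ) (D l)) / s) =
      ∑ l, S.indicator (1 : X → ℝ) (D l) := by field_simp
    rcases lt_abs.1 hD with h | h
    · right
      change s * t ≤ ∑ l, -(S.indicator (1 : X → ℝ) (D l) - P.real S)
      rw [Finset.sum_neg_distrib, hsum]
      nlinarith
    · left
      change s * t ≤ ∑ l, (S.indicator (1 : X → ℝ) (D l) - P.real S)
      rw [hsum]
      nlinarith
  calc _ ≤ _ := measureReal_mono hsub
    _ ≤ _ := measureReal_union_le _ _
    _ ≤ Real.exp (-2 * s * t ^ 2) + Real.exp (-2 * s * t ^ 2) :=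
      add_le_add (measure_sum_ge_le P hY hs ht) (measure_sum_ge_le P hY.neg hs ht)
    _ = _ := by ring

/-- The empirical frequencies of all Scheffé sets are close to their probabilities. -/
def IsRepresentative (H : HypothesisClass X n) (P : Measure X) {s : ℕ} (t : ℝ) (D : Fin s → X) :
    Prop :=
  ∀ i j, |P.real (H.scheffe i j) - (∑ l, (H.scheffe i j).indicator (1 : X → ℝ) (D l)) / s| ≤ t

theorem measurableSet_isRepresentative (H : HypothesisClass X n) (P : Measure X) (s : ℕ) (t : ℝ) :
    MeasurableSet {D : Fin s → X | IsRepresentative H P t D} := by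
  simp only [IsRepresentative, Set.ofPred_forall]
  refine MeasurableSet.iInter fun i => MeasurableSet.iInter fun j => measurableSet_le ?_ (by simp)
  have : ∀ l : Fin s, Measurable fun D : Fin s → X =>
      (H.scheffe i j).indicator (1 : X → ℝ) (D l) := fun l =>
    (measurable_one.indicator (measurableSet_scheffe H i j)).comp (measurable_pi_apply l)
  fun_prop

theorem measure_not_isRepresentative_le (H : HypothesisClass X n) (P : Measure X)
    [IsProbabilityMeasure P] {s : ℕ} (hs : 0 < s) {t : ℝ} (ht : 0 ≤ t) :
    (Measure.pi fun _ : Fin s => P).real {D | IsRepresentative H P t D}ᶜ ≤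
      n ^ 2 * (2 * Real.exp (-2 * s * t ^ 2)) := by
  have hsub : {D : Fin s → X | IsRepresentative H P t D}ᶜ ⊆
      ⋃ p ∈ (Finset.univ : Finset (Fin n × Fin n)), {D | t < |P.real (H.scheffe p.1 p.2) -
        (∑ l, (H.scheffe p.1 p.2).indicator (1 : X → ℝ) (D l)) / s|} := by
    intro D hD
    simp only [Set.mem_compl_iff, Set.mem_ofPred_eq, IsRepresentative, not_forall, not_le] at hD
    obtain ⟨i, j, h⟩ := hD
    exact Set.mem_biUnion (x := (i, j)) (Finset.mem_univ _) h
  refine (measureReal_mono hsub (measure_ne_top _ _)).trans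
    ((measureReal_biUnion_finset_le _ _).trans ?_)
  refine (Finset.sum_le_sum fun p _ =>
    measure_abs_freq_sub_gt_le P (measurableSet_scheffe H p.1 p.2) hs ht).trans_eq ?_
  simp [sq]

/-! ### Draws from weights -/

/-- The probability of a set of indices under the distribution proportional to the weights `w`. -/
def mass (w : Fin n → ℝ) (B : Finset (Fin n)) : ℝ := (∑ j ∈ B, w j) / ∑ j, w j

theorem mass_nonneg {w : Fin n → ℝ} (h0 : ∀ j, 0 ≤ w j) (B : Finset (Fin n)) : 0 ≤ mass w B :=
  div_nonneg (Finset.sum_nonneg fun j _ => h0 j) (Finset.sum_nonneg fun j _ => h0 j)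

theorem mass_union_le {w : Fin n → ℝ} (h0 : ∀ j, 0 ≤ w j) (B C : Finset (Fin n)) :
    mass w (B ∪ C) ≤ mass w B + mass w C := by
  rw [mass, mass, mass, ← add_div]
  refine div_le_div_of_nonneg_right ?_ (Finset.sum_nonneg fun j _ => h0 j)
  rw [← Finset.sum_union_inter]
  exact le_add_of_nonneg_right (Finset.sum_nonneg fun j _ => h0 j)

theorem mean_drawIndex_indicator {w : Fin n → ℝ} (h0 : ∀ j, 0 ≤ w j) (B : Finset (Fin n)) :
    mean H (drawIndex w : Prog X n (Fin n)) (fun j => if j ∈ B then 1 else 0) =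
      ENNReal.ofReal (mass w B) := by
  rw [mean_drawIndex, mass, Finset.sum_div, ENNReal.ofReal_sum_of_nonneg fun j _ =>
    div_nonneg (h0 j) (Finset.sum_nonneg fun j _ => h0 j)]
  simp [Finset.sum_ite_mem]

/-- The generating function of the number of hits of `B` in a list of independent draws. -/
theorem mean_drawList_pow {w : Fin n → ℝ} (h0 : ∀ j, 0 ≤ w j) (hw : 0 < ∑ j, w j)
    (B : Finset (Fin n)) {x : ℝ} (hx : 0 < x) (k : ℕ) (c : ℝ≥0∞) :
    mean H (drawList w k : Prog X n (List (Fin n)))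
        (fun K => c * ENNReal.ofReal (x ^ K.countP fun j => decide (j ∈ B))) =
      c * ENNReal.ofReal ((1 + (x - 1) * mass w B) ^ k) := by
  have hone : ∑ j, w j / (∑ i, w i) * (if j ∈ B then x else 1) = 1 + (x - 1) * mass w B := by
    have : ∀ j, w j / (∑ i, w i) * (if j ∈ B then x else 1) =
        w j / (∑ i, w i) + (x - 1) * (if j ∈ B then w j / (∑ i, w i) else 0) := fun j => by
      split_ifs <;> ring
    simp only [this, Finset.sum_add_distrib, ← Finset.mul_sum, Finset.sum_ite_mem,
      Finset.univ_inter, mass, Finset.sum_div]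
    rw [← Finset.sum_div, div_self hw.ne']
  have hnn : ∀ j, 0 ≤ w j / (∑ i, w i) * (if j ∈ B then x else 1) := fun j =>
    mul_nonneg (div_nonneg (h0 j) hw.le) (by split_ifs <;> positivity)
  have h1 : 0 ≤ 1 + (x - 1) * mass w B := hone ▸ Finset.sum_nonneg fun j _ => hnn j
  induction k generalizing c with
  | zero => simp [drawList]
  | succ k ih =>
    have hstep : ∀ j, mean H (drawList w k : Prog X n (List (Fin n)))
        (fun K => c * ENNReal.ofReal (x ^ (j :: K).countP fun j => decide (j ∈ B))) =
        c * ENNReal.ofReal (if j ∈ B then x else 1) *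
          ENNReal.ofReal ((1 + (x - 1) * mass w B) ^ k) := fun j => by
      rw [← ih]
      congr 1
      funext K
      rw [mul_assoc, ← ENNReal.ofReal_mul (by split_ifs <;> positivity), List.countP_cons]
      by_cases hj : j ∈ B
      · simp [hj, pow_succ, mul_comm]
      · simp [hj]
    simp only [drawList, mean_bind, mean_op, hstep, mean_drawIndex]
    have hterm : ∀ j, ENNReal.ofReal (w j / ∑ i, w i) * (c * ENNReal.ofReal
        (if j ∈ B then x else 1) * ENNReal.ofReal ((1 + (x - 1) * mass w B) ^ k)) =
        ENNReal.ofReal (w j / (∑ i, w i) * (if j ∈ B then x else 1)) *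
          (c * ENNReal.ofReal ((1 + (x - 1) * mass w B) ^ k)) := fun j => by
      rw [ENNReal.ofReal_mul (div_nonneg (h0 j) hw.le)]; ring
    rw [Finset.sum_congr rfl fun j _ => hterm j, ← Finset.sum_mul,
      ← ENNReal.ofReal_sum_of_nonneg fun j _ => hnn j, hone, pow_succ,
      ENNReal.ofReal_mul (pow_nonneg h1 k)]
    ring

/-- Chernoff bound: an event of mass at most `p` is rarely hit `2 p k` times in `k` draws. -/
theorem mean_drawList_many_le {w : Fin n → ℝ} (h0 : ∀ j, 0 ≤ w j) (hw : 0 < ∑ j, w j)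
    (B : Finset (Fin n)) {p : ℝ} (hp0 : 0 ≤ p) (hp : mass w B ≤ p) (k : ℕ) :
    mean H (drawList w k : Prog X n (List (Fin n)))
        (fun K => if 2 * p * k ≤ (K.countP fun j => decide (j ∈ B) : ℕ) then 1 else 0) ≤
      ENNReal.ofReal (Real.exp (-(p * k / 3))) := by
  have hl := Real.log_two_gt_d9
  have h2 : ∀ N : ℕ, (2 : ℝ) ^ N = Real.exp (N * Real.log 2) := fun N => by
    rw [Real.exp_nat_mul, Real.exp_log two_pos]
  calc _ ≤ mean H (drawList w k : Prog X n (List (Fin n))) (fun K =>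
        ENNReal.ofReal (Real.exp (-(2 * p * k * Real.log 2))) *
          ENNReal.ofReal (2 ^ K.countP fun j => decide (j ∈ B))) := by
        refine mean_mono _ fun K => ?_
        split_ifs with h
        · rw [h2, ← ENNReal.ofReal_mul (Real.exp_pos _).le, ← Real.exp_add]
          exact one_le_loss (by nlinarith)
        · exact zero_le
    _ = ENNReal.ofReal (Real.exp (-(2 * p * k * Real.log 2))) *
        ENNReal.ofReal ((1 + (2 - 1) * mass w B) ^ k) :=
      mean_drawList_pow h0 hw B two_pos k _
    _ ≤ _ := by
        rw [← ENNReal.ofReal_mul (Real.exp_pos _).le]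
        refine ENNReal.ofReal_le_ofReal ?_
        have h3 : 1 + (2 - 1) * mass w B ≤ Real.exp p := by
          have := Real.add_one_le_exp p; linarith
        have h4 : (1 + (2 - 1) * mass w B) ^ k ≤ Real.exp (k * p) := by
          rw [Real.exp_nat_mul]
          exact pow_le_pow_left₀ (by have := mass_nonneg h0 B; linarith) h3 k
        calc _ ≤ Real.exp (-(2 * p * k * Real.log 2)) * Real.exp (k * p) := by gcongr
          _ ≤ _ := by
            rw [← Real.exp_add]
            refine Real.exp_le_exp.2 ?_
            have : 0 ≤ p * k := by positivity
            nlinarith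

/-- Chernoff bound: an event of mass at least `p` is rarely hit fewer than `p k / 2` times in `k`
draws. -/
theorem mean_drawList_few_le {w : Fin n → ℝ} (h0 : ∀ j, 0 ≤ w j) (hw : 0 < ∑ j, w j)
    (B : Finset (Fin n)) {p : ℝ} (hp0 : 0 ≤ p) (hp : p ≤ mass w B) (k : ℕ) :
    mean H (drawList w k : Prog X n (List (Fin n)))
        (fun K => if (K.countP fun j => decide (j ∈ B) : ℕ) < p * k / 2 then 1 else 0) ≤
      ENNReal.ofReal (Real.exp (-(p * k / 8))) := by
  have hl := Real.log_two_lt_d9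
  have h2 : ∀ N : ℕ, (1 / 2 : ℝ) ^ N = Real.exp (-(N * Real.log 2)) := fun N => by
    rw [← mul_neg, ← Real.log_inv, Real.exp_nat_mul, Real.exp_log (by norm_num), one_div]
  have hm1 : mass w B ≤ 1 := by
    rw [mass, div_le_one hw]
    exact Finset.sum_le_sum_of_subset_of_nonneg (Finset.subset_univ _) fun j _ _ => h0 j
  calc _ ≤ mean H (drawList w k : Prog X n (List (Fin n))) (fun K =>
        ENNReal.ofReal (Real.exp (p * k / 2 * Real.log 2)) *
          ENNReal.ofReal ((1 / 2) ^ K.countP fun j => decide (j ∈ B))) := by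
        refine mean_mono _ fun K => ?_
        split_ifs with h
        · rw [h2, ← ENNReal.ofReal_mul (Real.exp_pos _).le, ← Real.exp_add]
          have := Real.log_pos one_lt_two
          exact one_le_loss (by nlinarith)
        · exact zero_le
    _ = ENNReal.ofReal (Real.exp (p * k / 2 * Real.log 2)) *
        ENNReal.ofReal ((1 + (1 / 2 - 1) * mass w B) ^ k) :=
      mean_drawList_pow h0 hw B (by norm_num) k _
    _ ≤ _ := by
        rw [← ENNReal.ofReal_mul (Real.exp_pos _).le]
        refine ENNReal.ofReal_le_ofReal ?_
        have h3 : 1 + (1 / 2 - 1) * mass w B ≤ Real.exp (-(p / 2)) := by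
          have := Real.add_one_le_exp (-(p / 2)); linarith
        have h4 : (1 + (1 / 2 - 1) * mass w B) ^ k ≤ Real.exp (k * -(p / 2)) := by
          rw [Real.exp_nat_mul]
          exact pow_le_pow_left₀ (by linarith) h3 k
        calc _ ≤ Real.exp (p * k / 2 * Real.log 2) * Real.exp (k * -(p / 2)) := by gcongr
          _ ≤ _ := by
            rw [← Real.exp_add]
            refine Real.exp_le_exp.2 ?_
            have : 0 ≤ p * k := by positivity
            nlinarith

/-! ### Accuracy of the sparse vector technique -/

/-- The score of `H_i` is at least `a` exactly when an `η / 2` fraction of the list has a lift value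
of at least `a`. -/
theorem le_scoreValue_iff {s : ℕ} {η : ℝ} (hη : 0 < η) (hη2 : η ≤ 2) {K : List (Fin n)}
    (hK : 0 < K.length) (W : Fin n → ℝ) (D : Fin s → X) (i : Fin n) (a : ℝ) :
    a ≤ scoreValue H η K W D i ↔
      η / 2 * K.length ≤ (K.countP fun j => decide (a ≤ semiDist H D i j - W j) : ℕ) := by
  have hK' : (0 : ℝ) < K.length := Nat.cast_pos.2 hK
  have hpos : 0 < ⌈η / 2 * K.length⌉₊ := Nat.ceil_pos.2 (by positivity)
  have hle : ⌈η / 2 * K.length⌉₊ ≤ K.length := Nat.ceil_le.2 (by nlinarith)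
  rw [scoreValue, le_getD_insertionSort_iff _ (by rw [List.length_map]; omega),
    Nat.sub_add_cancel hpos, List.countP_map, Nat.ceil_le]
  rfl

/-- Apart from a failure probability of `e ^ (-t / b)` per noisy comparison, a hypothesis that is
found has a score of at least `a₁`, and all scores are below `a₂` if none is found. -/
theorem mean_scan_le_add {s : ℕ} {b t : ℝ} (hb : 0 < b) (ht : 0 ≤ t) {τ a₁ a₂ : ℝ}
    (h₁ : a₁ + t ≤ τ) (h₂ : τ ≤ a₂ - t) (η : ℝ) (K : List (Fin n)) (W : Fin n → ℝ) (D : Fin s → X)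
    (R : List (Fin n)) {φ : Option (Fin n) → ℝ≥0∞} (hφ : ∀ r, φ r ≤ 1) {M : ℝ≥0∞}
    (hsome : ∀ i ∈ R, a₁ ≤ scoreValue H η K W D i → φ (some i) ≤ M)
    (hnone : (∀ i ∈ R, scoreValue H η K W D i < a₂) → φ none ≤ M) :
    mean H (scan b τ η K W D R) φ ≤ R.length * ENNReal.ofReal (Real.exp (-t / b)) + M := by
  induction R with
  | nil => simpa [mean_scan_nil] using hnone
  | cons i R ih =>
    rw [mean_scan_cons]
    have hab := above_add_below hb (scoreValue H η K W D i) τ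
    set p := aboveProb b (scoreValue H η K W D i) τ
    set p' := belowProb b (scoreValue H η K W D i) τ
    set δ := ENNReal.ofReal (Real.exp (-t / b))
    have hp1 : p' ≤ 1 := hab ▸ le_add_self
    have hcast : ((i :: R).length : ℝ≥0∞) * δ + M = δ + (R.length * δ + M) := by
      rw [List.length_cons]; push_cast; ring
    rw [hcast]
    by_cases hi₂ : a₂ ≤ scoreValue H η K W D i
    · have hle : p' ≤ δ := (measure_mono fun ν (hν : ¬ τ ≤ scoreValue H η K W D i + ν) =>
        (by change ν < -t; linarith : ν ∈ Set.Iio (-t))).trans (laplace_Iio_le hb ht)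
      have hM := hsome i (by simp) (by linarith)
      calc _ ≤ 1 * M + δ * 1 := by
            gcongr
            · exact hab ▸ le_self_add
            · exact (isProb_scan hb τ η K W D R).mean_le_one hφ
        _ = δ + M := by ring
        _ ≤ _ := by gcongr; exact le_add_self
    · have hIH := ih (fun j hj => hsome j (by simp [hj])) fun h => hnone fun j hj => by
        rcases List.mem_cons.1 hj with rfl | hj
        · exact not_le.1 hi₂
        · exact h j hj
      by_cases hi₁ : a₁ ≤ scoreValue H η K W D i
      · have hM := hsome i (by simp) hi₁
        calc _ ≤ p * (R.length * δ + M) + p' * (R.length * δ + M) := by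
              gcongr
              exact hM.trans le_add_self
          _ = R.length * δ + M := by rw [← add_mul, hab, one_mul]
          _ ≤ _ := le_add_self
      · have hle : p ≤ δ := (measure_mono fun ν (hν : τ ≤ scoreValue H η K W D i + ν) =>
          (by change t < ν; linarith : ν ∈ Set.Ioi t)).trans (laplace_Ioi_le hb ht)
        calc _ ≤ δ * 1 + 1 * (R.length * δ + M) := by
              gcongr
              exact hφ _
          _ = _ := by rw [mul_one, one_mul]

theorem mean_findPrompting_le_add {s : ℕ} (hs : 0 < s) {ε t : ℝ} (hε : 0 < ε) (ht : 0 ≤ t)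
    {σ' a₁ a₂ : ℝ} (h₁ : a₁ + 2 * t ≤ 3 * σ' / 4) (h₂ : 3 * σ' / 4 ≤ a₂ - 2 * t) (η : ℝ)
    (R K : List (Fin n)) (W : Fin n → ℝ) (D : Fin s → X) {φ : Option (Fin n) → ℝ≥0∞}
    (hφ : ∀ r, φ r ≤ 1) {M : ℝ≥0∞}
    (hsome : ∀ i ∈ R, a₁ ≤ scoreValue H η K W D i → φ (some i) ≤ M)
    (hnone : (∀ i ∈ R, scoreValue H η K W D i < a₂) → φ none ≤ M) :
    mean H (findPrompting ε (2 / s) σ' η R K W D) φ ≤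
      (R.length + 2) * ENNReal.ofReal (Real.exp (-t / (2 * (2 / s) / (ε / 2)))) + M := by
  have hs' : (0 : ℝ) < s := Nat.cast_pos.2 hs
  have hb : 0 < 2 * (2 / (s : ℝ)) / (ε / 2) := by positivity
  have hb' : 0 < 2 / (s : ℝ) / (ε / 2) := by positivity
  set b := 2 * (2 / (s : ℝ)) / (ε / 2) with hbdef
  set δ := ENNReal.ofReal (Real.exp (-t / b))
  have := isProbabilityMeasure_laplace hb'
  have hbb : 2 / (s : ℝ) / (ε / 2) ≤ b := by
    rw [hbdef]; gcongr; have : 0 < 2 / (s : ℝ) := by positivity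
    linarith
  have hδ : ENNReal.ofReal (Real.exp (-t / (2 / (s : ℝ) / (ε / 2)))) ≤ δ := by
    refine ENNReal.ofReal_le_ofReal (Real.exp_le_exp.2 ?_)
    rw [neg_div, neg_div, neg_le_neg_iff]
    exact div_le_div_of_nonneg_left ht hb' hbb
  have hmeas : MeasurableSet (Set.Ioi t ∪ Set.Iio (-t)) := measurableSet_Ioi.union measurableSet_Iio
  rw [mean_findPrompting]
  calc _ ≤ ∫⁻ ρ, (Set.Ioi t ∪ Set.Iio (-t)).indicator 1 ρ + (R.length * δ + M)
          ∂(laplace (2 / s / (ε / 2))) := by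
        refine lintegral_mono fun ρ => ?_
        simp only
        by_cases hρ : ρ ∈ Set.Ioi t ∪ Set.Iio (-t)
        · rw [Set.indicator_of_mem hρ]
          exact ((isProb_scan hb _ η K W D R).mean_le_one hφ).trans le_self_add
        · rw [Set.indicator_of_notMem hρ, zero_add]
          have h3 : ρ ≤ t := not_lt.1 fun h => hρ (Or.inl h)
          have h4 : -t ≤ ρ := not_lt.1 fun h => hρ (Or.inr h)
          exact mean_scan_le_add hb ht (by linarith) (by linarith) η K W D R hφ hsome hnone
    _ = laplace (2 / s / (ε / 2)) (Set.Ioi t ∪ Set.Iio (-t)) + (R.length * δ + M) := by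
        rw [lintegral_add_right _ measurable_const, lintegral_indicator_one hmeas,
          lintegral_const, measure_univ, mul_one]
    _ ≤ (δ + δ) + (R.length * δ + M) := by
        gcongr
        exact (measure_union_le _ _).trans (add_le_add ((laplace_Ioi_le hb' ht).trans hδ)
          ((laplace_Iio_le hb' ht).trans hδ))
    _ = _ := by ring

/-! ### Accuracy of the main loop -/

theorem gibbs_pos (ε Δ : ℝ) (W : Fin n → ℝ) (j : Fin n) : 0 < gibbs ε Δ W j := Real.exp_pos _

theorem sum_gibbs_pos (hn : 0 < n) (ε Δ : ℝ) (W : Fin n → ℝ) : 0 < ∑ j, gibbs ε Δ W j :=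
  sum_exp_pos hn _

theorem gibbs_one_div {s : ℕ} (ε : ℝ) (W : Fin n → ℝ) (j : Fin n) :
    gibbs ε (1 / s) W j = Real.exp (-(ε * s / 2 * W j)) := by
  rw [gibbs]
  congr 2
  by_cases hs : (s : ℝ) = 0
  · simp [hs]
  · field_simp

/-- The hypotheses whose proxy distance is too small by at least `a`, judged by `H_i`. -/
def liftSet (H : HypothesisClass X n) {s : ℕ} (D : Fin s → X) (W : Fin n → ℝ) (i : Fin n) (a : ℝ) :
    Finset (Fin n) :=
  Finset.univ.filter fun j => a ≤ semiDist H D i j - W j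

theorem mem_liftSet {s : ℕ} {D : Fin s → X} {W : Fin n → ℝ} {i : Fin n} {a : ℝ} {j : Fin n} :
    j ∈ liftSet H D W i a ↔ a ≤ semiDist H D i j - W j := by
  simp [liftSet]

/-- The proxy distances `W` are lower bounds coming from actual tests. -/
def IsProxy (H : HypothesisClass X n) {s : ℕ} (D : Fin s → X) (W : Fin n → ℝ) : Prop :=
  ∀ j, W j = 0 ∨ ∃ i, W j = semiDist H D i j

theorem IsProxy.update {s : ℕ} {D : Fin s → X} {W : Fin n → ℝ} (h : IsProxy H D W) (i : Fin n) :
    IsProxy H D fun j => max (W j) (semiDist H D i j) := fun j => by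
  rcases max_choice (W j) (semiDist H D i j) with h' | h'
  · simpa only [h'] using h j
  · exact Or.inr ⟨i, h'⟩

theorem semiDist_le_one {s : ℕ} (D : Fin s → X) (i j : Fin n) : semiDist H D i j ≤ 1 := by
  have := isProbabilityMeasure_law H j
  have h1 : (H.law j).real (H.scheffe i j) ≤ 1 := measureReal_le_one
  have h2 : 0 ≤ (H.law j).real (H.scheffe i j) := measureReal_nonneg
  have h3 : 0 ≤ (∑ l, (H.scheffe i j).indicator (1 : X → ℝ) (D l)) / s :=
    div_nonneg (Finset.sum_nonneg fun l _ => Set.indicator_nonneg (fun _ _ => zero_le_one) _)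
      (Nat.cast_nonneg s)
  have h4 : (∑ l, (H.scheffe i j).indicator (1 : X → ℝ) (D l)) / s ≤ 1 := by
    refine div_le_one_of_le₀ ?_ (Nat.cast_nonneg s)
    refine (Finset.sum_le_sum fun l _ =>
      Set.indicator_le' (g := fun _ => (1 : ℝ)) (fun _ _ => le_rfl) (fun _ _ => zero_le_one)
        (D l)).trans_eq (by simp)
  rw [semiDist, abs_le]
  constructor <;> linarith

theorem IsProxy.le_one {s : ℕ} {D : Fin s → X} {W : Fin n → ℝ} (h : IsProxy H D W) (j : Fin n) :
    W j ≤ 1 := by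
  rcases h j with h | ⟨i, h⟩ <;> rw [h]
  · exact zero_le_one
  · exact semiDist_le_one D i j

/-- The potential argument: a hypothesis that prompts a substantial change for a set of mass
`β / 16` decreases the normalizing constant of the weights by a factor `1 - β / 32`. -/
theorem sum_gibbs_update_le (hn : 0 < n) {s : ℕ} {D : Fin s → X} {W : Fin n → ℝ} {i : Fin n}
    {ε β a : ℝ} (hε : 0 ≤ ε) (ha : Real.log 2 ≤ ε * s / 2 * a)
    (hmass : β / 16 ≤ mass (gibbs ε (1 / s) W) (liftSet H D W i a)) :
    ∑ j, gibbs ε (1 / s) (fun j => max (W j) (semiDist H D i j)) j ≤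
      (1 - β / 32) * ∑ j, gibbs ε (1 / s) W j := by
  have hS := sum_gibbs_pos hn ε (1 / s) W
  rw [mass, le_div_iff₀ hS] at hmass
  have hterm : ∀ j, gibbs ε (1 / s) (fun j => max (W j) (semiDist H D i j)) j ≤
      gibbs ε (1 / s) W j -
        1 / 2 * (if j ∈ liftSet H D W i a then gibbs ε (1 / s) W j else 0) := fun j => by
    have hl : 0 ≤ ε * s / 2 := by positivity
    rw [gibbs_one_div, gibbs_one_div]
    split_ifs with hj
    · rw [mem_liftSet] at hj
      have h1 : Real.exp (-(ε * s / 2 * max (W j) (semiDist H D i j))) ≤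
          Real.exp (-Real.log 2) * Real.exp (-(ε * s / 2 * W j)) := by
        rw [← Real.exp_add]
        refine Real.exp_le_exp.2 ?_
        have h2 : W j + a ≤ max (W j) (semiDist H D i j) := le_max_of_le_right (by linarith)
        have h3 := mul_le_mul_of_nonneg_left h2 hl
        linarith
      rw [Real.exp_neg (Real.log 2), Real.exp_log two_pos] at h1
      linarith
    · rw [mul_zero, sub_zero]
      refine Real.exp_le_exp.2 (neg_le_neg ?_)
      exact mul_le_mul_of_nonneg_left (le_max_left _ _) hl
  refine (Finset.sum_le_sum fun j _ => hterm j).trans ?_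
  rw [Finset.sum_sub_distrib, ← Finset.mul_sum, Finset.sum_ite_mem, Finset.univ_inter]
  linarith

/-- The list `K` misrepresents the weights: it misses a large set of hypotheses for `i₀`, or it
overrates a small set of hypotheses for some `i`. -/
def IsMisleading (H : HypothesisClass X n) {s : ℕ} (D : Fin s → X) (W w : Fin n → ℝ) (β σ : ℝ)
    (k : ℕ) (i₀ : Fin n) (K : List (Fin n)) : Prop :=
  (β / 4 ≤ mass w (liftSet H D W i₀ (σ / 4)) ∧
      (K.countP fun j => decide (j ∈ liftSet H D W i₀ (σ / 4)) : ℕ) < β / 8 * k) ∨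
    ∃ i, mass w (liftSet H D W i (σ / 8)) ≤ β / 16 ∧
      β / 8 * k ≤ (K.countP fun j => decide (j ∈ liftSet H D W i (σ / 8)) : ℕ)

open Classical in
theorem mean_isMisleading_le (hn : 0 < n) {s : ℕ} (D : Fin s → X) (W : Fin n → ℝ)
    {w : Fin n → ℝ} (hw : ∀ j, 0 < w j) {β : ℝ} (hβ : 0 ≤ β) (σ : ℝ) (k : ℕ) (i₀ : Fin n) :
    mean H (drawList w k : Prog X n (List (Fin n)))
        (fun K => if IsMisleading H D W w β σ k i₀ K then 1 else 0) ≤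
      (n + 1) * ENNReal.ofReal (Real.exp (-(β * k / 50))) := by
  have h0 : ∀ j, 0 ≤ w j := fun j => (hw j).le
  have hpos : 0 < ∑ j, w j := Finset.sum_pos (fun j _ => hw j) ⟨⟨0, hn⟩, Finset.mem_univ _⟩
  have hP := isProb_drawList (H := H) h0 hpos k
  have hbk : 0 ≤ β * k := by positivity
  set f : List (Fin n) → ℝ≥0∞ := fun K =>
    if β / 4 ≤ mass w (liftSet H D W i₀ (σ / 4)) then
      (if (K.countP fun j => decide (j ∈ liftSet H D W i₀ (σ / 4)) : ℕ) < β / 4 * k / 2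
        then 1 else 0) else 0 with hf
  set g : Fin n → List (Fin n) → ℝ≥0∞ := fun i K =>
    if mass w (liftSet H D W i (σ / 8)) ≤ β / 16 then
      (if 2 * (β / 16) * k ≤ (K.countP fun j => decide (j ∈ liftSet H D W i (σ / 8)) : ℕ)
        then 1 else 0) else 0 with hg
  have hf' : mean H (drawList w k : Prog X n (List (Fin n))) f ≤
      ENNReal.ofReal (Real.exp (-(β * k / 50))) := by
    by_cases h : β / 4 ≤ mass w (liftSet H D W i₀ (σ / 4))
    · simp only [hf, h, if_true]
      refine (mean_drawList_few_le h0 hpos _ (by positivity) h k).trans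
        (ENNReal.ofReal_le_ofReal (Real.exp_le_exp.2 ?_))
      linarith
    · simp only [hf, h, if_false, hP.const]
      exact zero_le
  have hg' : ∀ i, mean H (drawList w k : Prog X n (List (Fin n))) (g i) ≤
      ENNReal.ofReal (Real.exp (-(β * k / 50))) := fun i => by
    by_cases h : mass w (liftSet H D W i (σ / 8)) ≤ β / 16
    · simp only [hg, h, if_true]
      refine (mean_drawList_many_le h0 hpos _ (by positivity) h k).trans
        (ENNReal.ofReal_le_ofReal (Real.exp_le_exp.2 ?_))
      linarith
    · simp only [hg, h, if_false, hP.const]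
      exact zero_le
  calc _ ≤ mean H (drawList w k : Prog X n (List (Fin n))) fun K => (∑ i, g i K) + f K := by
        refine mean_mono _ fun K => ?_
        split_ifs with h
        · rcases h with ⟨h1, h2⟩ | ⟨i, h1, h2⟩
          · refine le_trans ?_ le_add_self
            rw [hf]
            simp only [h1, if_true]
            rw [if_pos (by linarith)]
          · refine le_trans (le_trans ?_ (Finset.single_le_sum (f := fun i => g i K)
              (fun _ _ => zero_le) (Finset.mem_univ i))) le_self_add
            rw [hg]
            simp only [h1, if_true]
            rw [if_pos (by linarith)]
        · exact zero_le
    _ ≤ _ := by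
        rw [hP.add, hP.mean_sum, add_mul, one_mul]
        refine add_le_add ((Finset.sum_le_sum fun i _ => hg' i).trans_eq ?_) hf'
        simp

/-- The invariant of the main loop. -/
structure LoopInvariant (H : HypothesisClass X n) {s : ℕ} (D : Fin s → X) (ε β : ℝ)
    (A : Finset (Fin n)) (W : Fin n → ℝ) : Prop where
  proxy : IsProxy H D W
  prompted : ∀ i ∈ A, ∀ j, semiDist H D i j ≤ W j
  potential : ∑ j, gibbs ε (1 / s) W j ≤ n * (1 - β / 32) ^ A.card

/-- The aim of the main loop: `H_{i₀}` refutes the proxy distances of few hypotheses only. -/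
def IsSettled (H : HypothesisClass X n) {s : ℕ} (D : Fin s → X) (ε β σ : ℝ) (i₀ : Fin n)
    (W : Fin n → ℝ) : Prop :=
  IsProxy H D W ∧ mass (gibbs ε (1 / s) W) (liftSet H D W i₀ (σ / 4)) ≤ β / 4

theorem IsProxy.isSettled {s : ℕ} {D : Fin s → X} {W : Fin n → ℝ} (h : IsProxy H D W) {i₀ : Fin n}
    (h₀ : ∀ j, semiDist H D i₀ j ≤ W j) (ε : ℝ) {β σ : ℝ} (hβ : 0 ≤ β) (hσ : 0 < σ) :
    IsSettled H D ε β σ i₀ W := by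
  refine ⟨h, ?_⟩
  have : liftSet H D W i₀ (σ / 4) = ∅ := Finset.eq_empty_of_forall_notMem fun j hj => by
    rw [mem_liftSet] at hj
    have := h₀ j
    linarith
  rw [this, mass, Finset.sum_empty, zero_div]
  positivity

/-- The main loop ends with settled proxy distances, up to a failure probability of `δ` per round:
either a round finds no prompting hypothesis, or all hypotheses have been prompting, or the
potential would have dropped below the weight of a single hypothesis. -/
theorem mean_rounds_le_add (hn : 0 < n) {s : ℕ} (hs : 0 < s) {εE εS β σ δ γ : ℝ} (hE : 0 < εE)
    (hS : 0 < εS) (hβ0 : 0 < β) (hβ1 : β < 1) (hσ : 0 < σ) (hδ0 : 0 ≤ δ) (hγ0 : 0 ≤ γ)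
    {k T : ℕ} (hk : 0 < k)
    (hlog : Real.log 2 ≤ εE * s / 2 * (σ / 8))
    (hδ : (n + 1) * Real.exp (-(β * k / 50)) +
      (n + 2) * Real.exp (-(σ / 32) / (2 * (2 / s) / (εS / 2))) ≤ δ)
    (hT : T = n ∨ n * (1 - β / 32) ^ T < Real.exp (-(εE * s / 2)))
    (D : Fin s → X) (i₀ : Fin n) {φ : (Fin n → ℝ) → ℝ≥0∞} (hφ : ∀ W, φ W ≤ 1)
    (hφγ : ∀ W, IsSettled H D εE β σ i₀ W → φ W ≤ ENNReal.ofReal γ) (t : ℕ)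
    (A : Finset (Fin n)) (W : Fin n → ℝ) (hI : LoopInvariant H D εE β A W)
    (hA : A.card + t = T) :
    mean H (rounds εE εS σ β k D t A W) φ ≤ ENNReal.ofReal (t * δ + γ) := by
  classical
  induction t generalizing A W with
  | zero =>
    rw [rounds]
    simp only [mean_pure, Nat.cast_zero, zero_mul, zero_add]
    rw [add_zero] at hA
    refine hφγ W ?_
    rcases hT with h | h
    · have hu : A = Finset.univ := by
        rw [← Finset.card_eq_iff_eq_univ, Fintype.card_fin]; omega
      exact hI.proxy.isSettled (hI.prompted i₀ (hu ▸ Finset.mem_univ _)) _ hβ0.le hσ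
    · exfalso
      have h1 := hI.potential
      rw [hA] at h1
      have h2 : gibbs εE (1 / s) W i₀ ≤ ∑ j, gibbs εE (1 / s) W j :=
        Finset.single_le_sum (fun j _ => (gibbs_pos _ _ _ j).le) (Finset.mem_univ i₀)
      have h3 : Real.exp (-(εE * s / 2)) ≤ gibbs εE (1 / s) W i₀ := by
        rw [gibbs_one_div]
        refine Real.exp_le_exp.2 (neg_le_neg ?_)
        exact mul_le_of_le_one_right (by positivity) (hI.proxy.le_one i₀)
      linarith
  | succ t ih =>
    have htδ : 0 ≤ t * δ + γ := by positivity
    have hw : ∀ j, 0 < gibbs εE (1 / s) W j := gibbs_pos _ _ _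
    have hP := isProb_drawList (H := H) (fun j => (hw j).le) (sum_gibbs_pos hn _ _ _) k
    have hφF : ∀ r : Option (Fin n), (r.elim (φ W) fun i => mean H (rounds εE εS σ β k D t
        (insert i A) fun j => max (W j) (semiDist H D i j)) φ) ≤ 1 := by
      rintro (_ | i)
      · exact hφ W
      · exact (isProb_rounds hn hs hS σ β k D t _ _).mean_le_one hφ
    set e := Real.exp (-(β * k / 50))
    set d := Real.exp (-(σ / 32) / (2 * (2 / s) / (εS / 2)))
    have hd : 0 ≤ d := (Real.exp_pos _).le
    have he : 0 ≤ e := (Real.exp_pos _).le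
    rw [mean_rounds_succ]
    refine (hP.mean_le_add (ensures_drawList _ k)
      (IsMisleading H D W (gibbs εE (1 / s) W) β σ k i₀)
      (M := (n + 2) * ENNReal.ofReal d + ENNReal.ofReal (t * δ + γ)) ?_ ?_).trans ?_
    · exact fun K => (isProb_findPrompting hS (by positivity) _ _ _ K W D).mean_le_one hφF
    · intro K hK hKm
      simp only [IsMisleading, not_or, not_and, not_exists, not_lt, not_le] at hKm
      obtain ⟨hK₁, hK₂⟩ := hKm
      have hKlen : 0 < K.length := hK ▸ hk
      have hsc : ∀ i a, a ≤ scoreValue H (β / 4) K W D i ↔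
          β / 8 * k ≤ (K.countP fun j => decide (j ∈ liftSet H D W i a) : ℕ) := fun i a => by
        rw [le_scoreValue_iff (by positivity) (by linarith) hKlen W D i a, hK]
        simp only [mem_liftSet]
        rw [show β / 4 / 2 = β / 8 by ring]
      refine (mean_findPrompting_le_add hs hS (t := σ / 32) (by positivity) (a₁ := σ / 8)
        (a₂ := σ / 4) (by linarith) (by linarith) (β / 4) _ K W D hφF
        (M := ENNReal.ofReal (t * δ + γ)) ?_ ?_).trans ?_
      · intro i hi hscore
        have hiA : i ∉ A := by simpa using hi
        have hmass : β / 16 ≤ mass (gibbs εE (1 / s) W) (liftSet H D W i (σ / 8)) := by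
          by_contra h
          exact absurd ((hsc i _).1 hscore) (not_le.2 (hK₂ i (not_le.1 h).le))
        refine ih (insert i A) _ ⟨hI.proxy.update i, ?_, ?_⟩ ?_
        · intro i' hi' j
          rcases Finset.mem_insert.1 hi' with rfl | hi'
          · exact le_max_right _ _
          · exact (hI.prompted i' hi' j).trans (le_max_left _ _)
        · rw [Finset.card_insert_of_notMem hiA, pow_succ]
          refine (sum_gibbs_update_le hn hE.le hlog hmass).trans ?_
          have := mul_le_mul_of_nonneg_left hI.potential (by linarith : 0 ≤ 1 - β / 32)
          linarith
        · rw [Finset.card_insert_of_notMem hiA]; omega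
      · intro hall
        refine (hφγ W ?_).trans
          (ENNReal.ofReal_le_ofReal (le_add_of_nonneg_left (by positivity)))
        by_cases h₀ : i₀ ∈ A
        · exact hI.proxy.isSettled (hI.prompted i₀ h₀) _ hβ0.le hσ
        · refine ⟨hI.proxy, ?_⟩
          by_contra h
          exact absurd ((hsc i₀ _).2 (hK₁ (not_le.1 h).le)) (not_le.2 (hall i₀ (by simp [h₀])))
      · gcongr
        rw [length_filter_notMem]
        exact Nat.sub_le _ _
    · refine (add_le_add_left (mean_isMisleading_le hn D W hw hβ0.le σ k i₀) _).trans ?_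
      have h1 : ((n : ℝ≥0∞) + 1) = ENNReal.ofReal (n + 1) := by
        rw [ENNReal.ofReal_add (by positivity) zero_le_one]; simp
      have h2 : ((n : ℝ≥0∞) + 2) = ENNReal.ofReal (n + 2) := by
        rw [ENNReal.ofReal_add (by positivity) zero_le_two]; simp
      rw [h1, h2, ← ENNReal.ofReal_mul (by positivity), ← ENNReal.ofReal_mul (by positivity),
        ← ENNReal.ofReal_add (by positivity) htδ, ← ENNReal.ofReal_add (by positivity)
          (by positivity)]
      refine ENNReal.ofReal_le_ofReal ?_
      push_cast
      linarith

/-! ### Accuracy of the output -/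

/-- On a representative sample the empirical semi-distances are close to the true ones. -/
theorem abs_semiDist_sub_semiDist_le {s : ℕ} {D : Fin s → X} {P : Measure X} {t : ℝ}
    (hD : IsRepresentative H P t D) (i j : Fin n) :
    abs (semiDist H D i j - |(H.law j).real (H.scheffe i j) - P.real (H.scheffe i j)|) ≤ t := by
  refine (abs_abs_sub_abs_le _ _).trans ?_
  rw [sub_sub_sub_cancel_left]
  exact hD i j

open Classical in
/-- The conditions on the parameters are, in this order, those for the final draw by the exponential
mechanism, for the decrease of the potential, for the failure probability of a round and for the
number of rounds. -/
theorem mean_selectHypothesis_failure_le (hn : 0 < n) {s : ℕ} (hs : 0 < s) {ε β σ : ℝ}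
    (hε : 0 < ε) (hβ0 : 0 < β) (hβ1 : β < 1) (hσ : 0 < σ) {k T : ℕ} (hk : 0 < k) (hT0 : 0 < T)
    (hTn : T ≤ n) {lam : ℝ} (hlam : lam = ε / (2 * (k * T + 1)) * s / 2)
    (hexp : n * Real.exp (-(lam * (σ / 4))) ≤ β / 4)
    (hlog : Real.log 2 ≤ lam * (σ / 8))
    (hδ : (n + 1) * Real.exp (-(β * k / 50)) +
      (n + 2) * Real.exp (-(σ / 32) / (2 * (2 / s) / (ε / (2 * T) / 2))) ≤ β / (4 * n))
    (hT : T = n ∨ n * (1 - β / 32) ^ T < Real.exp (-lam))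
    (P : Measure X) [IsProbabilityMeasure P] (D : Fin s → X)
    (hD : IsRepresentative H P (σ / 16) D) :
    mean H (selectHypothesis n s T k ε β σ D)
        (fun j => if tvDist (H.law j) P ≤ 3 * H.opt P + σ then 0 else 1) ≤
      ENNReal.ofReal (3 * β / 4) := by
  have hn' : (0 : ℝ) < n := Nat.cast_pos.2 hn
  have hT' : (0 : ℝ) < T := Nat.cast_pos.2 hT0
  have : Nonempty (Fin n) := ⟨⟨0, hn⟩⟩
  obtain ⟨i₀, hi₀⟩ := exists_eq_ciInf_of_finite (f := fun i => tvDist (H.law i) P)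
  have hopt : tvDist (H.law i₀) P = H.opt P := hi₀
  rw [mean_selectHypothesis]
  set εE := ε / (2 * (k * T + 1))
  have hE : 0 < εE := by positivity
  subst hlam
  -- the union bound: `β / (4 n)` for each of at most `n` rounds, and `β / 2` for the final draw
  refine (mean_rounds_le_add (δ := β / (4 * n)) (γ := β / 2) hn hs hE (by positivity) hβ0 hβ1 hσ
    (by positivity) (by positivity) hk hlog hδ hT D i₀ ?_ ?_ T ∅ (fun _ => 0)
    ⟨fun j => Or.inl rfl, fun i hi => absurd hi (Finset.notMem_empty i), ?_⟩
    (by rw [Finset.card_empty, zero_add])).trans ?_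
  · intro W
    refine (IsProb.drawIndex (fun j => (gibbs_pos _ _ _ j).le)
      (sum_gibbs_pos hn _ _ _)).mean_le_one fun j => ?_
    split_ifs <;> simp
  · rintro W ⟨hproxy, hmass⟩
    have hw : ∀ j, 0 < gibbs εE (1 / s) W j := gibbs_pos _ _ _
    have hw0 : ∀ j, 0 ≤ gibbs εE (1 / s) W j := fun j => (hw j).le
    -- the hypotheses whose proxy distance exceeds that of the best one noticeably
    set C : Finset (Fin n) := Finset.univ.filter fun j => W i₀ + σ / 4 ≤ W j with hC
    have hCmass : mass (gibbs εE (1 / s) W) C ≤ β / 4 := by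
      refine le_trans ?_ hexp
      rw [mass, div_le_iff₀ (sum_gibbs_pos hn _ _ _)]
      have h1 : gibbs εE (1 / s) W i₀ ≤ ∑ j, gibbs εE (1 / s) W j :=
        Finset.single_le_sum (fun j _ => hw0 j) (Finset.mem_univ i₀)
      have h2 : ∀ j ∈ C, gibbs εE (1 / s) W j ≤
          Real.exp (-(εE * s / 2 * (σ / 4))) * ∑ j, gibbs εE (1 / s) W j := fun j hj => by
        refine le_trans ?_ (mul_le_mul_of_nonneg_left h1 (Real.exp_pos _).le)
        rw [gibbs_one_div, gibbs_one_div, ← Real.exp_add]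
        refine Real.exp_le_exp.2 ?_
        have h3 : W i₀ + σ / 4 ≤ W j := by simpa [hC] using hj
        have h4 := mul_le_mul_of_nonneg_left h3 (by positivity : 0 ≤ εE * s / 2)
        linarith
      refine (Finset.sum_le_card_nsmul C _ _ h2).trans ?_
      rw [nsmul_eq_mul, mul_assoc]
      have h3 : (C.card : ℝ) ≤ n := by
        have := Finset.card_le_univ C
        rw [Fintype.card_fin] at this
        exact_mod_cast this
      exact mul_le_mul_of_nonneg_right h3 (mul_nonneg (Real.exp_pos _).le
        (sum_gibbs_pos hn _ _ _).le)
    have hbad : ∀ j, j ∉ liftSet H D W i₀ (σ / 4) ∪ C →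
        tvDist (H.law j) P ≤ 3 * H.opt P + σ := fun j hj => by
      rw [Finset.mem_union, not_or, mem_liftSet, not_le] at hj
      obtain ⟨hj1, hj2⟩ := hj
      have hj2 : W j < W i₀ + σ / 4 := by simpa [hC] using hj2
      have h1 := tvDist_law_le H P i₀ j
      have h2 := (abs_le.1 (abs_semiDist_sub_semiDist_le hD i₀ j)).1
      have h3 : W i₀ ≤ H.opt P + σ / 16 := by
        rcases hproxy i₀ with h | ⟨i, h⟩ <;> rw [h]
        · have := tvDist_nonneg (H.law i₀) P
          linarith
        · have := isProbabilityMeasure_law H i₀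
          have h4 := (abs_le.1 (abs_semiDist_sub_semiDist_le hD i i₀)).2
          have h5 := le_tvDist (H.law i₀) P (measurableSet_scheffe H i i₀)
          linarith
      linarith
    calc _ ≤ mean H (drawIndex (gibbs εE (1 / s) W) : Prog X n (Fin n))
          (fun j => if j ∈ liftSet H D W i₀ (σ / 4) ∪ C then 1 else 0) := by
          refine mean_mono _ fun j => ?_
          by_cases hj : j ∈ liftSet H D W i₀ (σ / 4) ∪ C
          · rw [if_pos hj]; split_ifs <;> simp
          · rw [if_pos (hbad j hj)]; exact zero_le
      _ = ENNReal.ofReal (mass (gibbs εE (1 / s) W) (liftSet H D W i₀ (σ / 4) ∪ C)) :=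
          mean_drawIndex_indicator hw0 _
      _ ≤ _ := by
          refine ENNReal.ofReal_le_ofReal ((mass_union_le hw0 _ _).trans ?_)
          linarith
  · simp [gibbs]
  · refine ENNReal.ofReal_le_ofReal ?_
    have hTn' : (T : ℝ) ≤ n := Nat.cast_le.2 hTn
    have : T * (β / (4 * n)) ≤ β / 4 := by
      rw [mul_div_assoc', div_le_div_iff₀ (by positivity) (by positivity)]
      nlinarith
    linarith

open Classical in
/-- Accuracy is a lower bound on a probability; it follows from the upper bound on the complementary
one. -/
theorem prob_add_failure {α : Type} {p : Prog X n α} (hp : IsProb H p) (E : α → Prop) :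
    p.prob H (fun a _ => E a) + mean H p (fun a => if E a then 0 else 1) = 1 := by
  refine ((hp.add _ _).symm.trans ?_).trans (hp.const 1)
  congr 1
  funext a
  split_ifs <;> simp

/-! ### The choice of the parameters -/

theorem exp_neg_log_div {β : ℝ} (hn : 0 < n) (hβ : 0 < β) :
    Real.exp (-Real.log (n / β)) = β / n := by
  have hn' : (0 : ℝ) < n := Nat.cast_pos.2 hn
  rw [Real.exp_neg, Real.exp_log (by positivity), inv_div]

theorem log_pos_of_params {β : ℝ} (hn : 1 ≤ n) (hβ0 : 0 < β) (hβ1 : β < 1) :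
    0 < Real.log (n / β) := by
  have hn' : (1 : ℝ) ≤ n := Nat.one_le_cast.2 hn
  exact Real.log_pos ((one_lt_div hβ0).2 (by linarith))

theorem log_two_le_of_params {β : ℝ} (hn : 2 ≤ n) (hβ0 : 0 < β) (hβ1 : β < 1) :
    Real.log 2 ≤ Real.log (n / β) := by
  have hn' : (2 : ℝ) ≤ n := Nat.ofNat_le_cast.2 hn
  exact Real.log_le_log two_pos ((le_div_iff₀ hβ0).2 (by linarith))

theorem one_le_cube_bound {L : ℝ} (hL : 69 / 100 ≤ L) : 1 ≤ 4 * L ^ 3 := by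
  have : (69 / 100 : ℝ) ^ 3 ≤ L ^ 3 := pow_le_pow_left₀ (by norm_num) hL 3
  linarith

/-- The rates `x = L / (β σ)`, `y = L / β` and `r = L ^ 3 / (β ^ 2 σ ^ 2 ε)` that govern the number
of rounds, the length of the lists and the number of samples, where `L = log (n / β)`. -/
structure RateBounds (ε β σ L x y r : ℝ) : Prop where
  log_ge : 69 / 100 ≤ L
  le_x : L ≤ x
  le_y : L ≤ y
  le_r : 1 ≤ 4 * r
  y_le_r : y ≤ 3 * r
  xβσ : x * β * σ = L
  yβ : y * β = L
  rεσ : r * ε * σ = L * x * y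
  rσσ : L ^ 3 ≤ r * σ ^ 2

theorem rateBounds {ε β σ : ℝ} (hn : 2 ≤ n) (hε0 : 0 < ε) (hε1 : ε < 1) (hβ0 : 0 < β)
    (hβ1 : β < 1) (hσ0 : 0 < σ) (hσ1 : σ < 1) :
    RateBounds ε β σ (Real.log (n / β)) (Real.log (n / β) / (β * σ)) (Real.log (n / β) / β)
      (sampleRate n ε β σ) := by
  have hL2 := log_two_le_of_params hn hβ0 hβ1
  have h2 := Real.log_two_gt_d9
  have hL : 69 / 100 ≤ Real.log (n / β) := by linarith
  unfold sampleRate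
  generalize Real.log (n / β) = L at hL
  have hL0 : 0 < L := by linarith
  have hβσ : β * σ ≤ 1 := mul_le_one₀ hβ1.le hσ0.le hσ1.le
  have hββ : β ^ 2 ≤ β := by nlinarith
  have hσσ : σ ^ 2 ≤ 1 := pow_le_one₀ hσ0.le hσ1.le
  have hσε : σ ^ 2 * ε ≤ 1 := mul_le_one₀ hσσ hε0.le hε1.le
  have hβε : β ^ 2 * ε ≤ 1 := mul_le_one₀ (pow_le_one₀ hβ0.le hβ1.le) hε0.le hε1.le
  have hall : β ^ 2 * σ ^ 2 * ε ≤ β := by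
    rw [mul_assoc]
    calc _ ≤ β * 1 := mul_le_mul hββ hσε (by positivity) hβ0.le
      _ = β := mul_one β
  refine ⟨hL, ?_, ?_, ?_, ?_, by field_simp, by field_simp, by field_simp, ?_⟩
  · exact le_div_self hL0.le (by positivity) hβσ
  · exact le_div_self hL0.le hβ0 hβ1.le
  · have h1 : L ^ 3 ≤ L ^ 3 / (β ^ 2 * σ ^ 2 * ε) :=
      le_div_self (by positivity) (by positivity) (hall.trans hβ1.le)
    have := one_le_cube_bound hL
    linarith
  · have h1 : L ^ 3 / β ≤ L ^ 3 / (β ^ 2 * σ ^ 2 * ε) :=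
      div_le_div_of_nonneg_left (by positivity) (by positivity) hall
    have h3 : L ≤ 3 * L ^ 3 := by
      have : (69 / 100 : ℝ) ^ 2 ≤ L ^ 2 := pow_le_pow_left₀ (by norm_num) hL 2
      nlinarith
    calc L / β ≤ 3 * L ^ 3 / β := by gcongr
      _ = 3 * (L ^ 3 / β) := by ring
      _ ≤ _ := by gcongr
  · have : L ^ 3 / (β ^ 2 * σ ^ 2 * ε) * σ ^ 2 = L ^ 3 / (β ^ 2 * ε) := by field_simp
    rw [this]
    exact le_div_self (by positivity) (by positivity) hβε

/-- The bounds on the rounded parameters for the constants `20040000`, `1000` and `400`. -/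
structure ParamBounds (n : ℕ) (x y r : ℝ) (s T k : ℕ) : Prop where
  le_s : 20040000 * r ≤ s
  s_le : s ≤ 20040004 * r
  T_le : T ≤ 1002 * min x n
  le_T : min x n ≤ T
  T_le_n : T ≤ n
  T_cases : T = n ∨ 1000 * x ≤ T
  le_k : 400 * y ≤ k
  k_le : k ≤ 402 * y

theorem RateBounds.paramBounds {ε β σ L x y r : ℝ} (h : RateBounds ε β σ L x y r) :
    ParamBounds n x y r ⌈20040000 * r⌉₊ (min ⌈1000 * x⌉₊ n) ⌈400 * y⌉₊ := by
  obtain ⟨hL, hx, hy, hr, -, -, -, -, -⟩ := h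
  have hceil : ∀ z : ℝ, 0 ≤ z → (⌈z⌉₊ : ℝ) ≤ z + 1 := fun z hz => (Nat.ceil_lt_add_one hz).le
  have hn0 : (0 : ℝ) ≤ n := Nat.cast_nonneg n
  have hTx := hceil (1000 * x) (by linarith)
  refine ⟨Nat.le_ceil _, ?_, ?_, ?_, min_le_right _ _, ?_, Nat.le_ceil _, ?_⟩
  · linarith [hceil (20040000 * r) (by linarith)]
  · rw [Nat.cast_min, mul_min_of_nonneg _ _ (by norm_num : (0 : ℝ) ≤ 1002)]
    exact min_le_min (by linarith) (by linarith)
  · rw [Nat.cast_min]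
    exact min_le_min (by linarith [Nat.le_ceil (1000 * x)]) le_rfl
  · rcases le_total ⌈1000 * x⌉₊ n with h | h
    · right; rw [min_eq_left h]; exact Nat.le_ceil _
    · left; exact min_eq_right h
  · linarith [hceil (400 * y) (by linarith)]

section

variable {ε β σ L x y r : ℝ} {s T k : ℕ}

/-- The draws by the exponential mechanism have enough budget: the mechanism exceeds the optimum by
`σ / 4` with probability at most `n (β / n) ^ 3`. -/
theorem selection_exponent_ge (h : RateBounds ε β σ L x y r) (hp : ParamBounds n x y r s T k)
    (hε : 0 < ε) (hσ : 0 < σ) : 3 * L ≤ ε / (2 * (k * T + 1)) * s / 2 * (σ / 4) := by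
  obtain ⟨hL, hx, hy, hr, -, -, -, hrεσ, -⟩ := h
  have hL0 : 0 < L := by linarith
  have hx0 : 0 < x := by linarith
  have hy0 : 0 < y := by linarith
  have hxy : 1 ≤ 3 * (y * x) := by nlinarith
  have hT : (T : ℝ) ≤ 1002 * x := hp.T_le.trans (by gcongr; exact min_le_left _ _)
  have hkT : (k : ℝ) * T + 1 ≤ 402807 * (y * x) := by
    have := mul_le_mul hp.k_le hT (Nat.cast_nonneg T) (by linarith)
    linarith
  have h1 : ε / (2 * (k * T + 1)) * s / 2 * (σ / 4) = ε * σ * s / (16 * (k * T + 1)) := by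
    field_simp; ring
  rw [h1, le_div_iff₀ (by positivity)]
  have h2 : 20040000 * (L * x * y) ≤ ε * σ * s := by
    have := mul_le_mul_of_nonneg_left hp.le_s (by positivity : 0 ≤ ε * σ)
    rw [← hrεσ]; linarith
  have h3 := mul_le_mul_of_nonneg_left hkT (by positivity : 0 ≤ 48 * L)
  have h4 : 0 < L * x * y := by positivity
  linarith

/-- The Laplace noise exceeds `σ / 32` with probability at most `(β / n) ^ 8`. -/
theorem noise_exponent_ge (h : RateBounds ε β σ L x y r) (hp : ParamBounds n x y r s T k)
    (hε : 0 < ε) (hσ : 0 < σ) (hT0 : 0 < T) (hs0 : 0 < s) :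
    -(σ / 32) / (2 * (2 / s) / (ε / (2 * T) / 2)) ≤ -(8 * L) := by
  obtain ⟨hL, hx, hy, hr, -, -, -, hrεσ, -⟩ := h
  have hT' : (0 : ℝ) < T := Nat.cast_pos.2 hT0
  have hs' : (0 : ℝ) < s := Nat.cast_pos.2 hs0
  have hL0 : 0 < L := by linarith
  have hx0 : 0 < x := by linarith
  have hT : (T : ℝ) ≤ 1002 * x := hp.T_le.trans (by gcongr; exact min_le_left _ _)
  have h1 : -(σ / 32) / (2 * (2 / s) / (ε / (2 * T) / 2)) = -(ε * σ * s / (512 * T)) := by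
    field_simp; ring
  rw [h1, neg_le_neg_iff, le_div_iff₀ (by positivity)]
  have h2 : 20040000 * (L * x * y) ≤ ε * σ * s := by
    have := mul_le_mul_of_nonneg_left hp.le_s (by positivity : 0 ≤ ε * σ)
    rw [← hrεσ]; linarith
  have h3 := mul_le_mul_of_nonneg_left hT (by positivity : 0 ≤ 8 * L * 512)
  have h4 : L * x * (69 / 100) ≤ L * x * y := by gcongr; linarith
  have h5 : 0 < L * x := by positivity
  linarith

/-- The exponent of Hoeffding's inequality for deviations of `σ / 16`. -/
theorem sample_exponent_ge (h : RateBounds ε β σ L x y r) (hp : ParamBounds n x y r s T k) :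
    -2 * s * (σ / 16) ^ 2 ≤ -(8 * L) := by
  have hL := h.log_ge
  have h1 := mul_le_mul_of_nonneg_right hp.le_s (sq_nonneg σ)
  have h2 := h.rσσ
  have h3 : (69 / 100 : ℝ) ^ 2 ≤ L ^ 2 := pow_le_pow_left₀ (by norm_num) hL 2
  have h4 : (69 / 100) ^ 2 * L ≤ L ^ 3 := by nlinarith
  linarith

/-- There are enough rounds to bring the potential, which starts at `n`, below the least possible
weight of a hypothesis. This limits the budget of the exponential mechanism from above. -/
theorem pow_lt_exp_neg (h : RateBounds ε β σ (Real.log (n / β)) x y r)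
    (hp : ParamBounds n x y r s T k) (hn : 2 ≤ n) (hε : 0 < ε) (hβ0 : 0 < β) (hβ1 : β < 1)
    (hσ : 0 < σ) (hσ1 : σ < 1) (hT : 1000 * x ≤ T) :
    n * (1 - β / 32) ^ T < Real.exp (-(ε / (2 * (k * T + 1)) * s / 2)) := by
  have hn' : (0 : ℝ) < n := Nat.cast_pos.2 (by omega)
  obtain ⟨hL, hx, hy, hr, -, hxβσ, -, hrεσ, -⟩ := h
  have hnexp : (n : ℝ) ≤ Real.exp (Real.log (n / β)) := by
    rw [Real.exp_log (by positivity)]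
    exact le_div_self hn'.le hβ0 hβ1.le
  set L := Real.log (n / β)
  have hx0 : 0 < x := by linarith
  have hy0 : 0 < y := by linarith
  have hpow : (1 - β / 32) ^ T ≤ Real.exp (T * -(β / 32)) := by
    rw [Real.exp_nat_mul]
    refine pow_le_pow_left₀ (by linarith) ?_ T
    have := Real.add_one_le_exp (-(β / 32)); linarith
  calc _ ≤ Real.exp L * Real.exp (T * -(β / 32)) :=
        mul_le_mul hnexp hpow (pow_nonneg (by linarith) T) (Real.exp_pos _).le
    _ < _ := by
        rw [← Real.exp_add]
        refine Real.exp_lt_exp.2 ?_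
        -- both exponents are compared with multiples of `x * β = L / σ`
        have hxβ : L ≤ x * β := by
          rw [← hxβσ]; exact mul_le_of_le_one_right (by positivity) hσ1.le
        have hxβ0 : 0 < x * β := by positivity
        have h1 : 1000 * (x * β) ≤ T * β := by nlinarith
        have h2 : ε / (2 * (k * T + 1)) * s / 2 ≤ 13 * (x * β) := by
          have h3 : ε / (2 * (k * T + 1)) * s / 2 = ε * s / (4 * (k * T + 1)) := by
            field_simp; ring
          have hkT : 400000 * (y * x) ≤ k * T := by
            have := mul_le_mul hp.le_k hT (by positivity) (Nat.cast_nonneg k)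
            linarith
          have h4 : r * ε = x * β * (x * y) := by
            have : r * ε * σ = x * β * (x * y) * σ := by rw [hrεσ, ← hxβσ]; ring
            exact mul_right_cancel₀ hσ.ne' this
          have h5 : ε * s ≤ 20040004 * (x * β * (x * y)) := by
            have := mul_le_mul_of_nonneg_left hp.s_le hε.le
            rw [← h4]; linarith
          rw [h3, div_le_iff₀ (by positivity)]
          have h6 := mul_le_mul_of_nonneg_left hkT hxβ0.le
          have h7 : 0 < x * β * (x * y) := by positivity
          linarith
        linarith

end

/-! ### Putting the bounds together -/

theorem exists_params {ε β σ : ℝ} (hn : 1 ≤ n) (hε : ε ∈ Set.Ioo (0 : ℝ) 1)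
    (hβ : β ∈ Set.Ioo (0 : ℝ) 1) (hσ : σ ∈ Set.Ioo (0 : ℝ) 1) :
    0 < numSamples 20040000 n ε β σ ∧ 0 < numRounds 1000 n β σ ∧ 0 < listSize 400 n β := by
  have hL := log_pos_of_params hn hβ.1 hβ.2
  have hε0 := hε.1
  have hβ0 := hβ.1
  have hσ0 := hσ.1
  refine ⟨Nat.ceil_pos.2 ?_, lt_min (Nat.ceil_pos.2 ?_) hn, Nat.ceil_pos.2 ?_⟩
  · rw [sampleRate]; positivity
  · positivity
  · positivity

theorem dp_algorithm {ε β σ : ℝ} (hn : 1 ≤ n) (hε : ε ∈ Set.Ioo (0 : ℝ) 1)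
    (hβ : β ∈ Set.Ioo (0 : ℝ) 1) (hσ : σ ∈ Set.Ioo (0 : ℝ) 1)
    (D D' : Fin (numSamples 20040000 n ε β σ) → X) (hD : {l | D l ≠ D' l}.ncard = 1)
    (S : Set (Fin n)) :
    (algorithm 20040000 1000 400 n ε β σ D).prob H (fun i _ => i ∈ S) ≤
      ENNReal.ofReal (Real.exp ε) *
        (algorithm 20040000 1000 400 n ε β σ D').prob H (fun i _ => i ∈ S) := by
  obtain ⟨hs, hT, -⟩ := exists_params hn hε hβ hσ
  obtain ⟨l₀, hl₀⟩ := Set.ncard_eq_one.1 hD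
  have hN : Neighbors D D' := ⟨l₀, fun l hl => by
    by_contra h
    exact hl (by simpa using (hl₀ ▸ h : l ∈ ({l₀} : Set _)))⟩
  exact mean_selectHypothesis_le hs hT _ hε.1 β σ hN _

theorem accurate_algorithm_of_two_le {ε β σ : ℝ} (hn : 2 ≤ n) (hε : ε ∈ Set.Ioo (0 : ℝ) 1)
    (hβ : β ∈ Set.Ioo (0 : ℝ) 1) (hσ : σ ∈ Set.Ioo (0 : ℝ) 1) (P : Measure X)
    [IsProbabilityMeasure P] :
    ENNReal.ofReal (1 - β) ≤
      ∫⁻ D, (algorithm 20040000 1000 400 n ε β σ D).prob H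
        (fun i _ => tvDist (H.law i) P ≤ 3 * H.opt P + σ)
        ∂(Measure.pi fun _ : Fin (numSamples 20040000 n ε β σ) => P) := by
  classical
  obtain ⟨hs, hT, hk⟩ := exists_params (by omega : 1 ≤ n) hε hβ hσ
  obtain ⟨hε0, hε1⟩ := hε
  obtain ⟨hβ0, hβ1⟩ := hβ
  obtain ⟨hσ0, hσ1⟩ := hσ
  have hn0 : 0 < n := by omega
  have hn' : (2 : ℝ) ≤ n := Nat.ofNat_le_cast.2 hn
  have hr := rateBounds hn hε0 hε1 hβ0 hβ1 hσ0 hσ1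
  have hp : ParamBounds n _ _ _ (numSamples 20040000 n ε β σ) (numRounds 1000 n β σ)
    (listSize 400 n β) := hr.paramBounds
  set s := numSamples 20040000 n ε β σ
  set T := numRounds 1000 n β σ
  set k := listSize 400 n β
  have hu := exp_neg_log_div hn0 hβ0
  have hL2 := log_two_le_of_params hn hβ0 hβ1
  have hL0 := log_pos_of_params (by omega : 1 ≤ n) hβ0 hβ1
  have hlam := selection_exponent_ge hr hp hε0 hσ0
  set L := Real.log (n / β)
  have hpow : ∀ m : ℕ, Real.exp (-(m * L)) = (β / n) ^ m := fun m => by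
    rw [← hu, ← Real.exp_nat_mul, mul_neg]
  have hu0 : 0 < β / n := by positivity
  have hu2 : β / n ≤ 1 / 2 := by rw [div_le_div_iff₀ (by positivity) two_pos]; linarith
  have hun : n * (β / n) = β := by field_simp
  have hpow8 : Real.exp (-(8 * L)) = (β / n) ^ 8 := by exact_mod_cast hpow 8
  have hpow3 : Real.exp (-(3 * L)) = (β / n) ^ 3 := by exact_mod_cast hpow 3
  have hfail : ∀ D : Fin s → X, IsRepresentative H P (σ / 16) D →
      ENNReal.ofReal (1 - 3 * β / 4) ≤ (selectHypothesis n s T k ε β σ D).prob H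
        (fun i _ => tvDist (H.law i) P ≤ 3 * H.opt P + σ) := fun D hD => by
    have hadd := prob_add_failure (isProb_selectHypothesis (H := H) hn0 hs hT hε0 k β σ D)
      fun i => tvDist (H.law i) P ≤ 3 * H.opt P + σ
    have hle := mean_selectHypothesis_failure_le hn0 hs hε0 hβ0 hβ1 hσ0 hk hT hp.T_le_n rfl
      ?_ ?_ ?_ ?_ P D hD
    · rw [ENNReal.ofReal_sub _ (by positivity), ENNReal.ofReal_one, tsub_le_iff_right, ← hadd]
      gcongr
    · calc _ ≤ n * Real.exp (-(3 * L)) := by gcongr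
        _ = β * (β / n) ^ 2 := by rw [hpow3]; field_simp
        _ ≤ β * (1 / 2) ^ 2 := by gcongr
        _ = β / 4 := by ring
    · linarith
    · have h1 : Real.exp (-(β * k / 50)) ≤ Real.exp (-(8 * L)) := by
        refine Real.exp_le_exp.2 ?_
        have := mul_le_mul_of_nonneg_right hp.le_k hβ0.le
        have := hr.yβ
        linarith
      have h2 := Real.exp_le_exp.2 (noise_exponent_ge hr hp hε0 hσ0 hT hs)
      calc _ ≤ (n + 1) * Real.exp (-(8 * L)) + (n + 2) * Real.exp (-(8 * L)) := by gcongr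
        _ = (2 * n + 3) * (β / n) ^ 8 := by rw [hpow8]; ring
        _ ≤ (4 * n) * (β / n) ^ 8 := by gcongr; linarith
        _ = 4 * β * (β / n) * (β / n) ^ 6 := by nth_rw 2 [← hun]; ring
        _ ≤ 4 * 1 * (β / n) * (1 / 2) ^ 6 := by gcongr
        _ ≤ 1 / 4 * (β / n) := by linarith
        _ = β / (4 * n) := by field_simp
    · rcases hp.T_cases with h | h
      · exact Or.inl h
      · exact Or.inr (pow_lt_exp_neg hr hp hn hε0 hβ0 hβ1 hσ0 hσ1 h)
  set μ := Measure.pi fun _ : Fin s => P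
  have hmeas := measurableSet_isRepresentative H P s (σ / 16)
  have hrep : 1 - β / 4 ≤ μ.real {D | IsRepresentative H P (σ / 16) D} := by
    have h1 := measure_not_isRepresentative_le H P hs (by positivity : 0 ≤ σ / 16)
    have h2 := Real.exp_le_exp.2 (sample_exponent_ge hr hp)
    have h3 : (n : ℝ) ^ 2 * (2 * Real.exp (-2 * s * (σ / 16) ^ 2)) ≤ β / 4 := by
      calc _ ≤ (n : ℝ) ^ 2 * (2 * Real.exp (-(8 * L))) := by gcongr
        _ = 2 * β * β * (β / n) ^ 6 := by rw [hpow8]; nth_rw 2 3 [← hun]; ring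
        _ ≤ 2 * β * 1 * (1 / 2) ^ 6 := by gcongr
        _ ≤ β / 4 := by linarith
    rw [probReal_compl_eq_one_sub hmeas] at h1
    linarith
  calc ENNReal.ofReal (1 - β) ≤ ENNReal.ofReal ((1 - 3 * β / 4) * (1 - β / 4)) :=
        ENNReal.ofReal_le_ofReal (by nlinarith)
    _ ≤ ENNReal.ofReal (1 - 3 * β / 4) * μ {D | IsRepresentative H P (σ / 16) D} := by
        rw [ENNReal.ofReal_mul (by linarith)]
        gcongr
        exact (ENNReal.ofReal_le_ofReal hrep).trans (ofReal_measureReal).le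
    _ = ∫⁻ D in {D | IsRepresentative H P (σ / 16) D}, ENNReal.ofReal (1 - 3 * β / 4) ∂μ := by
        rw [setLIntegral_const]
    _ ≤ _ := (setLIntegral_mono' hmeas fun D hD => hfail D hD).trans (setLIntegral_le_lintegral _ _)

/-- For `n = 1` the logarithm can be arbitrarily small, so that the concentration bounds fail, but
every output is optimal. -/
theorem accurate_algorithm_of_eq_one {ε β σ : ℝ} (hn : n = 1) (hε : ε ∈ Set.Ioo (0 : ℝ) 1)
    (hβ : β ∈ Set.Ioo (0 : ℝ) 1) (hσ : σ ∈ Set.Ioo (0 : ℝ) 1) (P : Measure X)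
    [IsProbabilityMeasure P] :
    ENNReal.ofReal (1 - β) ≤
      ∫⁻ D, (algorithm 20040000 1000 400 n ε β σ D).prob H
        (fun i _ => tvDist (H.law i) P ≤ 3 * H.opt P + σ)
        ∂(Measure.pi fun _ : Fin (numSamples 20040000 n ε β σ) => P) := by
  subst hn
  obtain ⟨hs, hT, -⟩ := exists_params le_rfl hε hβ hσ
  have hall : ∀ i, tvDist (H.law i) P ≤ 3 * H.opt P + σ := fun i => by
    have h1 : H.opt P = tvDist (H.law i) P := by
      rw [HypothesisClass.opt, ciInf_unique, Subsingleton.elim i default]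
    have h2 := tvDist_nonneg (H.law i) P
    have h3 := hσ.1
    linarith
  have h1 : ∀ D : Fin (numSamples 20040000 1 ε β σ) → X,
      (algorithm 20040000 1000 400 1 ε β σ D).prob H
        (fun i _ => tvDist (H.law i) P ≤ 3 * H.opt P + σ) = 1 := fun D => by
    rw [← (isProb_selectHypothesis (H := H) one_pos hs hT hε.1 (listSize 400 1 β) β σ D).const 1]
    simp only [Prog.prob, hall, if_true]
    rfl
  simp only [h1, lintegral_const, measure_univ, mul_one]
  exact ENNReal.ofReal_le_one.2 (by linarith [hβ.1])

theorem timeRate_eq {ε β σ : ℝ} (hε : 0 < ε) (hβ : 0 < β) (hσ : 0 < σ)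
    (hL : 0 < Real.log (n / β)) :
    timeRate n ε β σ = n * (Real.log (n / β) / β) * sampleRate n ε β σ *
      min (Real.log (n / β) / (β * σ)) n := by
  rw [timeRate, sampleRate, mul_min_of_nonneg _ _ (by positivity)]
  congr 1 <;> field_simp

/-- The constant collects the bounds on the parameters: `402` and `1002` for the length of the lists
and the number of rounds, and `721442556 = 36 * 20040004 + 2 * 402 * 3` for the cost of a score,
including that of sorting a list, which is dominated by the number of samples. -/
theorem prob_time_gt_eq_zero {ε β σ : ℝ} (hn : 2 ≤ n) (hε : ε ∈ Set.Ioo (0 : ℝ) 1)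
    (hβ : β ∈ Set.Ioo (0 : ℝ) 1) (hσ : σ ∈ Set.Ioo (0 : ℝ) 1)
    (D : Fin (numSamples 20040000 n ε β σ) → X) :
    (algorithm 20040000 1000 400 n ε β σ D).prob H
      (fun _ t => 402 * 1002 * 721442556 * timeRate n ε β σ < t) = 0 := by
  obtain ⟨hs, hT, hk⟩ := exists_params (by omega : 1 ≤ n) hε hβ hσ
  have hr := rateBounds hn hε.1 hε.2 hβ.1 hβ.2 hσ.1 hσ.2
  have hp : ParamBounds n _ _ _ (numSamples 20040000 n ε β σ) (numRounds 1000 n β σ)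
    (listSize 400 n β) := hr.paramBounds
  have hF := timeRate_eq hε.1 hβ.1 hσ.1 (log_pos_of_params (by omega : 1 ≤ n) hβ.1 hβ.2)
  refine ensures_selectHypothesis (by omega) hs hT hk ε β σ D _ fun _ t _ ht => if_neg ?_
  rw [not_lt, hF]
  have ht' : (t : ℝ) ≤ n * listSize 400 n β * numRounds 1000 n β σ *
      (36 * numSamples 20040000 n ε β σ + 2 * listSize 400 n β) := by exact_mod_cast ht
  refine ht'.trans ?_
  set x := Real.log (n / β) / (β * σ)
  set y := Real.log (n / β) / β
  set r := sampleRate n ε β σ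
  have hL := hr.log_ge
  have hx0 : 0 ≤ x := by linarith [hr.le_x]
  have hy0 : 0 ≤ y := by linarith [hr.le_y]
  have h1 : 36 * (numSamples 20040000 n ε β σ : ℝ) + 2 * listSize 400 n β ≤ 721442556 * r := by
    linarith [hp.s_le, hp.k_le, hr.y_le_r]
  calc _ ≤ n * (402 * y) * (1002 * min x n) * (721442556 * r) := by
        gcongr
        · exact hp.k_le
        · exact hp.T_le
    _ = _ := by ring

theorem prob_time_ge_pos {ε β σ : ℝ} (hn : 2 ≤ n) (hε : ε ∈ Set.Ioo (0 : ℝ) 1)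
    (hβ : β ∈ Set.Ioo (0 : ℝ) 1) (hσ : σ ∈ Set.Ioo (0 : ℝ) 1)
    (D : Fin (numSamples 20040000 n ε β σ) → X) :
    0 < (algorithm 20040000 1000 400 n ε β σ D).prob H
      (fun _ t => 1 * timeRate n ε β σ ≤ t) := by
  obtain ⟨hs, hT, hk⟩ := exists_params (by omega : 1 ≤ n) hε hβ hσ
  have hr := rateBounds hn hε.1 hε.2 hβ.1 hβ.2 hσ.1 hσ.2
  have hp : ParamBounds n _ _ _ (numSamples 20040000 n ε β σ) (numRounds 1000 n β σ)
    (listSize 400 n β) := hr.paramBounds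
  have hF := timeRate_eq hε.1 hβ.1 hσ.1 (log_pos_of_params (by omega : 1 ≤ n) hβ.1 hβ.2)
  obtain ⟨i, c, hc, q, hq, hqe⟩ := canTake_selectHypothesis (H := H) (by omega) hs hT hp.T_le_n
    hε.1 (listSize 400 n β) β σ D
  refine hq.trans_le ((hqe _).trans' ?_)
  rw [if_pos, mul_one]
  have hc' : (numRounds 1000 n β σ : ℝ) * n * (listSize 400 n β * numSamples 20040000 n ε β σ) ≤
      2 * c := by exact_mod_cast hc
  rw [one_mul, hF]
  set x := Real.log (n / β) / (β * σ)
  set y := Real.log (n / β) / β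
  set r := sampleRate n ε β σ
  have hL := hr.log_ge
  have hx0 : 0 ≤ x := by linarith [hr.le_x]
  have hy0 : 0 ≤ y := by linarith [hr.le_y]
  have hr0 : 0 ≤ r := by linarith [hr.le_r]
  have hm0 : 0 ≤ min x n := le_min hx0 (Nat.cast_nonneg n)
  have h1 : min x n * n * (400 * y * (20040000 * r)) ≤ 2 * c := by
    refine le_trans ?_ hc'
    gcongr
    · exact hp.le_T
    · exact hp.le_k
    · exact hp.le_s
  have h2 : 0 ≤ n * y * r * min x n := by positivity
  linarith

end HypSel

end

theorem theorem4p1 :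
    ∃ cs cT ck : ℝ, 0 < cs ∧ 0 < cT ∧ 0 < ck ∧
      -- privacy and accuracy
      (∀ (n : ℕ) (ε β σ : ℝ), 1 ≤ n → ε ∈ Set.Ioo (0 : ℝ) 1 → β ∈ Set.Ioo (0 : ℝ) 1 →
        σ ∈ Set.Ioo (0 : ℝ) 1 →
        ∀ (X : Type u) [MeasurableSpace X] (H : HypSel.HypothesisClass X n),
          HypSel.IsPrivateProperLearner 3 ε β σ H (HypSel.algorithm cs cT ck n ε β σ)) ∧
      -- sample complexity and (worst-case) running time
      ∃ a b : ℝ, 0 < a ∧ 0 < b ∧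
        ∀ (n : ℕ) (ε β σ : ℝ), 2 ≤ n → ε ∈ Set.Ioo (0 : ℝ) 1 → β ∈ Set.Ioo (0 : ℝ) 1 →
          σ ∈ Set.Ioo (0 : ℝ) 1 →
          (a * HypSel.sampleRate n ε β σ ≤ HypSel.numSamples cs n ε β σ ∧
            HypSel.numSamples cs n ε β σ ≤ b * HypSel.sampleRate n ε β σ) ∧
          ∀ (X : Type u) [MeasurableSpace X] (H : HypSel.HypothesisClass X n)
            (D : Fin (HypSel.numSamples cs n ε β σ) → X),
            (HypSel.algorithm cs cT ck n ε β σ D).prob H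
                (fun _ t => b * HypSel.timeRate n ε β σ < t) = 0 ∧
            0 < (HypSel.algorithm cs cT ck n ε β σ D).prob H
                (fun _ t => a * HypSel.timeRate n ε β σ ≤ t) := by
  refine ⟨20040000, 1000, 400, by norm_num, by norm_num, by norm_num, ?_,
    1, 402 * 1002 * 721442556, one_pos, by norm_num, ?_⟩
  · intro n ε β σ hn hε hβ hσ X _ H
    refine ⟨fun D D' hD S => HypSel.dp_algorithm hn hε hβ hσ D D' hD S, fun P _ => ?_⟩
    rcases hn.eq_or_lt with hn | hn
    · exact HypSel.accurate_algorithm_of_eq_one hn.symm hε hβ hσ P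
    · exact HypSel.accurate_algorithm_of_two_le hn hε hβ hσ P
  · intro n ε β σ hn hε hβ hσ
    have hr := HypSel.rateBounds hn hε.1 hε.2 hβ.1 hβ.2 hσ.1 hσ.2
    have hp : HypSel.ParamBounds n _ _ _ (HypSel.numSamples 20040000 n ε β σ) _ _ :=
      hr.paramBounds
    have hr0 := hr.le_r
    refine ⟨⟨?_, ?_⟩, fun X _ H D => ⟨HypSel.prob_time_gt_eq_zero hn hε hβ hσ D,
      HypSel.prob_time_ge_pos hn hε hβ hσ D⟩⟩
    · linarith [hp.le_s]
    · linarith [hp.s_le]
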